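/- Let $\Theta\subset\mathbb R^d$ be compact, let $f=\sum_{i=1}^n f_i$ with $f_i:\Theta\to\mathbb R$ measurable, let $\pi_0$ be a probability measure (the prior) on $\Theta$ and let $T\ge 1$. For each worker $m\in\{1,\dots,M\}$ and $t=1,\dots,T$ let $\mathcal I_t^{(m)}\subset\{1,\dots,n\}$ be a mini-batch of indices, $G_t^{(m)}=\exp\big(-\sum_{i\in\mathcal I_t^{(m)}}f_i\big)$, and $$\pi_0^{(m)}=\pi_0,\qquad \pi_t^{(m)}(d\theta)=\pi_{t-1}^{(m)}(d\theta)\,\frac{G_t^{(m)}(\theta)}{\int_\Theta G_t^{(m)}\,d\pi_{t-1}^{(m)}}.$$ **Sampler.** For every $N\ge1$ let $\kappa_N$ be a Markov kernel on $\Theta$ such that, for a constant $c_\kappa$ independent of $N$, $\sup_{\theta'}\int|\varphi(\theta)-\varphi(\theta')|\,\kappa_N(d\theta|\theta')\le c_\kappa\|\varphi\|_\infty/\sqrt N$ for all bounded measurable $\varphi:\Theta\to\mathbb R$. For every $N$, worker $m$ runs the sampler with $N$ particles: draw $\theta_0^{(i,m)}\sim\pi_0$ i.i.d., $i=1,\dots,N$;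 for $t=1,\dots,T$, given the past, draw independently $\hat\theta_t^{(i,m)}\sim\kappa_N(\cdot|\theta_{t-1}^{(i,m)})$, and then draw $\theta_t^{(1,m)},\dots,\theta_t^{(N,m)}$ i.i.d. from $\sum_j w_t^{(j,m)}\delta_{\hat\theta_t^{(j,m)}}$ with $w_t^{(j,m)}=G_t^{(m)}(\hat\theta_t^{(j,m)})/\sum_l G_t^{(m)}(\hat\theta_t^{(l,m)})$. All runs (over $m$ and $N$) live on one probability space. **Estimator.** Let $\mathsf k:\mathbb R^d\to[0,\infty)$ be a zero-mean probability density with finite second moment such that $\mathsf D^\alpha\mathsf k$ exists, is continuous and bounded for every $\alpha\in\{0,1\}^d$. With $h=\lfloor N^{1/(2(d+1))}\rfloor^{-1}$ and $\mathsf k_h(x)=h^{-d}\mathsf k(h^{-1}x)$ put $\mathsf p_T^{(m),N}(\theta)=\frac1N\sum_{i=1}^N\mathsf k_h(\theta-\theta_T^{(i,m)})$. **Assumptions.** (i) Every $G_t^{(m)}$, $1\le t\le T$, is bounded. (ii) For every $m$ and $1\le t\le T$, $\pi_t^{(m)}$ has a Lebesgue density, again written $\pi_t^{(m)}(\theta)$,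 which is Lipschitz on $\Theta$ and whose derivatives $\mathsf D^\alpha\pi_t^{(m)}$, $\alpha\in\{0,1\}^d$, exist and are Lipschitz on the interior of $\Theta$. (iii) The prior and the mini-batches are chosen so that $\pi_T^{(m)}(\theta)\propto\exp(-f(\theta))$ on $\Theta$ for every $m$ (for instance, $\pi_0$ uniform on $\Theta$ and $\mathcal I_1^{(m)},\dots,\mathcal I_T^{(m)}$ a partition of $\{1,\dots,n\}$). (iv) $\|f\|_\infty<\infty$, and $f$ attains its global minimum over $\Theta$ at some interior point of $\Theta$. **Conclusion.** Let $\theta^\star\in\operatorname{argmin}_{\theta\in\Theta}f(\theta)$. Then for every $\varepsilon\in(0,1)$ there is an almost surely finite random variable $\widetilde W=\widetilde W_{T,d,\varepsilon}$, independent of $N$, such that, almost surely, for every $N\ge1$, every worker $m$ (in particular the worker selected by the PSMCO algorithm) and every choice of $\theta_T^{\star,N}$ among the particles $\theta_T^{(i,m)}$, $1\le i\le N$, that maximize $\mathsf p_T^{(m),N}$ over these particles, $$0\le f(\theta_T^{\star,N})-f(\theta^\star)\le\frac{\widetilde W}{N^{\frac{1-\varepsilon}{2(d+1)}}}.$$ 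-/

import Mathlib

open MeasureTheory ProbabilityTheory Set

noncomputable section

namespace PSMCO

/-! ### Mixed partial derivatives of order at most one in each coordinate -/

/-- Partial derivative of `g` along the `i`-th coordinate. -/
def pderiv {d : ℕ} (i : Fin d) (g : EuclideanSpace ℝ (Fin d) → ℝ) :
    EuclideanSpace ℝ (Fin d) → ℝ :=
  fun x => lineDeriv ℝ g x (EuclideanSpace.single i 1)

/-- `∂_{i₁} (∂_{i₂} (⋯ g))` for the list `[i₁, i₂, …]`. -/
def iterPderiv {d : ℕ} : List (Fin d) → (EuclideanSpace ℝ (Fin d) → ℝ) →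
    EuclideanSpace ℝ (Fin d) → ℝ
  | [], g => g
  | i :: l, g => pderiv i (iterPderiv l g)

/-- All the derivatives taken successively in `iterPderiv l g` exist at every point of `S`. -/
def IterPderivExists {d : ℕ} (S : Set (EuclideanSpace ℝ (Fin d))) :
    List (Fin d) → (EuclideanSpace ℝ (Fin d) → ℝ) → Prop
  | [], _ => True
  | i :: l, g => IterPderivExists S l g ∧
      ∀ x ∈ S, LineDifferentiableAt ℝ (iterPderiv l g) x (EuclideanSpace.single i 1)

/-- The coordinates with `α_i = 1`, in increasing order; a multi-index `α ∈ {0,1}^d` is the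
finite set of these coordinates. -/
def multiIndex {d : ℕ} (α : Finset (Fin d)) : List (Fin d) :=
  (List.finRange d).filter (fun i => i ∈ α)

/-- `D^α g` for `α ∈ {0,1}^d`. -/
def mixedDeriv {d : ℕ} (α : Finset (Fin d)) (g : EuclideanSpace ℝ (Fin d) → ℝ) :
    EuclideanSpace ℝ (Fin d) → ℝ :=
  iterPderiv (multiIndex α) g

/-- `D^α g` exists on `S`, for `α ∈ {0,1}^d`. -/
def MixedDerivExists {d : ℕ} (S : Set (EuclideanSpace ℝ (Fin d))) (α : Finset (Fin d))
    (g : EuclideanSpace ℝ (Fin d) → ℝ) : Prop :=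
  IterPderivExists S (multiIndex α) g

/-! ### Cost function, potentials and target measures -/

section Targets

variable {d n : ℕ} {Θ : Set (EuclideanSpace ℝ (Fin d))}

/-- The cost function `f = ∑ f_i`. -/
def cost (f : Fin n → Θ → ℝ) (θ : Θ) : ℝ := ∑ i, f i θ

/-- The potential `G(θ) = exp (- ∑_{i ∈ B} f_i(θ))` of a mini-batch `B`. -/
def potential (f : Fin n → Θ → ℝ) (B : Finset (Fin n)) (θ : Θ) : ℝ :=
  Real.exp (-∑ i ∈ B, f i θ)

/-- The target measures: `π_{t+1}(dθ) = π_t(dθ) G_{t+1}(θ) / ∫ G_{t+1} dπ_t`. -/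
def target (π₀ : Measure Θ) (G : ℕ → Θ → ℝ) : ℕ → Measure Θ
  | 0 => π₀
  | t + 1 => (∫⁻ θ, ENNReal.ofReal (G (t + 1) θ) ∂(target π₀ G t))⁻¹ •
      (target π₀ G t).withDensity (fun θ => ENNReal.ofReal (G (t + 1) θ))

/-- `p` is a probability density function, with respect to Lebesgue measure on `Θ`, of the measure
`μ` on `Θ`. -/
def IsDensity (μ : Measure Θ) (p : EuclideanSpace ℝ (Fin d) → ℝ) : Prop :=
  (∀ θ ∈ Θ, 0 ≤ p θ) ∧
    μ = (Measure.comap Subtype.val volume).withDensity (fun θ => ENNReal.ofReal (p θ))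

end Targets

/-- Regularity of a density: `p` is Lipschitz on `Θ`, and for every `α ∈ {0,1}^d` the derivative
`D^α p` exists and is Lipschitz on the interior of `Θ`. -/
def LipschitzDerivatives {d : ℕ} (Θ : Set (EuclideanSpace ℝ (Fin d)))
    (p : EuclideanSpace ℝ (Fin d) → ℝ) : Prop :=
  (∃ L : ℝ, ∀ θ ∈ Θ, ∀ θ' ∈ Θ, |p θ - p θ'| ≤ L * ‖θ - θ'‖) ∧
  ∀ α : Finset (Fin d), MixedDerivExists (interior Θ) α p ∧
    ∃ L : ℝ, ∀ θ ∈ interior Θ, ∀ θ' ∈ interior Θ,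
      |mixedDeriv α p θ - mixedDeriv α p θ'| ≤ L * ‖θ - θ'‖

/-! ### The particle sampler -/

section Sampler

variable {S : Type*} [MeasurableSpace S]

/-- The jittering condition on the Markov kernels `κ N` (one for each number `N` of particles):
`sup_{θ'} ∫ |φ(θ) - φ(θ')| κ_N(dθ|θ') ≤ c ‖φ‖_∞ / √N` for all bounded measurable `φ`,
with `c` independent of `N`. Here `b` is any upper bound of `|φ|`. -/
def JitterCondition (κ : ℕ → Kernel S S) : Prop :=
  ∃ c : ℝ, ∀ N : ℕ, 1 ≤ N → ∀ φ : S → ℝ, Measurable φ → ∀ b : ℝ, (∀ θ, |φ θ| ≤ b) →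
    ∀ θ' : S, ∫ θ, |φ θ - φ θ'| ∂(κ N θ') ≤ c * b / Real.sqrt N

/-- Joint law of the jittered particles: independent, the `i`-th one drawn from `κ(· | x_i)`. -/
def jitterLaw {N : ℕ} (κ : Kernel S S) (x : Fin N → S) : Measure (Fin N → S) :=
  Measure.pi (fun i => κ (x i))

/-- Normalized weight of the `j`-th particle. -/
def weight {N : ℕ} (G : S → ℝ) (x : Fin N → S) (j : Fin N) : ℝ :=
  G (x j) / ∑ l, G (x l)

/-- Joint law of the resampled particles: i.i.d. draws from `∑_j w_j δ_{x_j}`. -/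
def resampleLaw {N : ℕ} (G : S → ℝ) (x : Fin N → S) : Measure (Fin N → S) :=
  Measure.pi (fun _ => ∑ j, ENNReal.ofReal (weight G x j) • Measure.dirac (x j))

/-- The σ-algebra generated by `X_0, …, X_t` and `Y_1, …, Y_t`. -/
@[reducible] def history {Ω V : Type*} [MeasurableSpace V] (X Y : ℕ → Ω → V) (t : ℕ) : MeasurableSpace Ω :=
  (⨆ s ∈ Set.Icc 0 t, MeasurableSpace.comap (X s) inferInstance) ⊔
    (⨆ s ∈ Set.Icc 1 t, MeasurableSpace.comap (Y s) inferInstance)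

/-- `X t ω i` (`0 ≤ t ≤ T`) are the particles `θ_t^{(i)}` and `Y t ω i` (`1 ≤ t ≤ T`) the jittered
particles `θ̂_t^{(i)}` of a run of the sampler with `N` particles, prior `π₀`, jittering kernel `κ`
and potentials `G_1, …, G_T`: the initial particles are i.i.d. from `π₀`; given the past, the
jittered particles have law `jitterLaw`; given the past and the jittered particles, the new
particles have law `resampleLaw`. -/
structure IsSamplerRun {Ω : Type*} [MeasurableSpace Ω] (Pr : Measure Ω) (N T : ℕ)
    (π₀ : Measure S) (κ : Kernel S S) (G : ℕ → S → ℝ) (X Y : ℕ → Ω → Fin N → S) : Prop where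
  measurable_particles : ∀ t, Measurable (X t)
  measurable_jittered : ∀ t, Measurable (Y t)
  initial : Pr.map (X 0) = Measure.pi (fun _ => π₀)
  jitter : ∀ t < T, ∀ A : Set (Fin N → S), MeasurableSet A →
    Pr⟦Y (t + 1) ⁻¹' A | history X Y t⟧ =ᵐ[Pr] fun ω => (jitterLaw κ (X t ω)).real A
  resample : ∀ t < T, ∀ A : Set (Fin N → S), MeasurableSet A →
    Pr⟦X (t + 1) ⁻¹' A |
        history X Y t ⊔ MeasurableSpace.comap (Y (t + 1)) inferInstance⟧
      =ᵐ[Pr] fun ω => (resampleLaw (G (t + 1)) (Y (t + 1) ω)).real A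

end Sampler

/-! ### Kernel density estimator -/

/-- Conditions on the smoothing kernel: a zero-mean probability density on `ℝ^d` with finite second
moment, such that `D^α k` exists, is continuous and bounded for all `α ∈ {0,1}^d`
(`α = 0` says that `k` itself is continuous and bounded). -/
structure IsSmoothingKernel {d : ℕ} (k : EuclideanSpace ℝ (Fin d) → ℝ) : Prop where
  nonneg : ∀ x, 0 ≤ k x
  integral_eq_one : ∫ x, k x = 1
  zero_mean : ∫ x, k x • x = 0
  second_moment : Integrable (fun x => ‖x‖ ^ 2 * k x)
  deriv_exists : ∀ α : Finset (Fin d), MixedDerivExists Set.univ α k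
  deriv_continuous : ∀ α : Finset (Fin d), Continuous (mixedDeriv α k)
  deriv_bounded : ∀ α : Finset (Fin d), ∃ C : ℝ, ∀ x, |mixedDeriv α k x| ≤ C

/-- The scaled kernel `k_h(x) = h^{-d} k(h^{-1} x)`. -/
def scaledKernel {d : ℕ} (k : EuclideanSpace ℝ (Fin d) → ℝ) (h : ℝ)
    (x : EuclideanSpace ℝ (Fin d)) : ℝ :=
  (h ^ d)⁻¹ * k (h⁻¹ • x)

/-- The bandwidth `h = ⌊N^{1/(2(d+1))}⌋^{-1}`. -/
def bandwidth (d N : ℕ) : ℝ :=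
  ((⌊(N : ℝ) ^ (1 / (2 * ((d : ℝ) + 1)))⌋₊ : ℕ) : ℝ)⁻¹

/-- The kernel density estimator `(1/N) ∑_i k_h(θ - x_i)` built on the particles `x`,
with `h = bandwidth d N`. -/
def kde {d N : ℕ} {Θ : Set (EuclideanSpace ℝ (Fin d))} (k : EuclideanSpace ℝ (Fin d) → ℝ)
    (x : Fin N → Θ) (θ : EuclideanSpace ℝ (Fin d)) : ℝ :=
  (1 / (N : ℝ)) * ∑ i, scaledKernel k (bandwidth d N) (θ - (x i : EuclideanSpace ℝ (Fin d)))

end PSMCO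

end

/-! The density of the last target is `exp (-f) / Z`, so nearly maximizing it is nearly minimizing
`f`; the inequality `x + 1 ≤ exp x` and the bound on `f` turn a density gap into a cost gap
(`sub_le_exp_mul_of_le`).

Sampling error. Given the past, the particles of each jittering or resampling step are independent,
so Hoeffding's inequality holds conditionally. Jittering adds a bias `O(N^{-1/2})`, and reweighting
is a ratio of two empirical means with a positive limiting denominator. Induction on time
(`IsSamplerRun.concentrates`) yields sub-Gaussian deviations at scale `N^{-1/2}` for every test
function bounded by one.

Density estimation. With `H = 1/h`, the scaled kernel has size `H^d` and Lipschitz constant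
`O(H^{d+1})`. Since `H^{d+1} ≤ √N`, a net of mesh `O(1/N)` and a union bound give a uniform error
`O(s/H)` (`Concentrates.uniform_scaledKernel`). The smoothing bias is `O(1/H)`. Some particle lies
within `O(s/H)` of an interior minimizer (`Concentrates.exists_mem_ball`). The best particle has at
least its estimated density, so its true density is within `O(s/H)` of the maximum
(`Concentrates.density_argmax`). Only an upper bias bound is needed at the best particle, which may
be near the boundary of `Θ`; the lower one is needed only near the interior minimizer.

Almost sure bound. With `s = N^{ε/(2(d+1))}` the failure probabilities remain summable after
multiplication by `N`, so the largest failing `N` is dominated by an almost surely finite variable,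
which enters the constant (`exists_measurable_bound_of_measure_le`). -/

noncomputable section

namespace PSMCO

/-! ### Hoeffding's inequality for product laws and for conditionally independent draws. -/

section Concentration

variable {S : Type*}

/-- The empirical mean of `φ` over the points `x`. -/
def empMean {N : ℕ} (φ : S → ℝ) (x : Fin N → S) : ℝ := (1 / (N : ℝ)) * ∑ i, φ (x i)

variable [MeasurableSpace S]

lemma measurable_empMean {N : ℕ} {φ : S → ℝ} (hφ : Measurable φ) :
    Measurable (empMean φ : (Fin N → S) → ℝ) := by
  unfold empMean
  fun_prop

/-- One-sided Hoeffding inequality for a product measure. -/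
lemma hoeffding_pi_upper {N : ℕ} (hN : 1 ≤ N) (μ : Fin N → Measure S)
    [∀ i, IsProbabilityMeasure (μ i)] {φ : S → ℝ} (hφ : Measurable φ) (hb : ∀ x, |φ x| ≤ 1)
    {s : ℝ} (hs : 0 ≤ s) :
    (Measure.pi μ).real {x | s / Real.sqrt N ≤ empMean φ x - (1 / (N : ℝ)) * ∑ i, ∫ y, φ y ∂μ i} ≤
      Real.exp (-s ^ 2 / 2) := by
  have hN0 : (0 : ℝ) < N := by exact_mod_cast hN
  have hsub : ∀ i ∈ (Finset.univ : Finset (Fin N)), HasSubgaussianMGF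
      (fun x : Fin N → S => φ (x i) - ∫ y, φ y ∂μ i) 1 (Measure.pi μ) := by
    intro i _
    have h := hasSubgaussianMGF_of_mem_Icc (μ := Measure.pi μ) (X := fun x => φ (x i)) (a := -1)
      (b := 1) (hφ.comp (measurable_pi_apply i)).aemeasurable (Filter.Eventually.of_forall fun x => abs_le.1 (hb (x i)))
    have h2 : (Measure.pi μ)[fun x => φ (x i)] = ∫ y, φ y ∂μ i := by
      rw [← (measurePreserving_eval μ i).map_eq, integral_map
        (measurable_pi_apply i).aemeasurable hφ.aestronglyMeasurable]
    rw [h2] at h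
    convert h
    ext
    norm_num
  have hind : iIndepFun (fun i (x : Fin N → S) => φ (x i) - ∫ y, φ y ∂μ i) (Measure.pi μ) :=
    iIndepFun_pi (X := fun i y => φ y - ∫ y, φ y ∂μ i) (fun i => by fun_prop)
  -- Values in `[-1, 1]` give variance proxy 1 per term and `N` for the sum, so the level `s * √N`
  -- has exponent `-s ^ 2 / 2`.
  have h := HasSubgaussianMGF.measure_sum_ge_le_of_iIndepFun hind hsub
    (ε := s * Real.sqrt N) (by positivity)
  have e1 : {x : Fin N → S | s / Real.sqrt N ≤
      empMean φ x - (1 / (N : ℝ)) * ∑ i, ∫ y, φ y ∂μ i} =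
      {x | s * Real.sqrt N ≤ ∑ i, (φ (x i) - ∫ y, φ y ∂μ i)} := by
    ext x
    simp only [mem_ofPred_eq, empMean]
    rw [Finset.sum_sub_distrib, ← mul_sub, div_mul_eq_mul_div, one_mul, div_le_div_iff₀
      (Real.sqrt_pos.2 hN0) hN0]
    have hq := Real.mul_self_sqrt hN0.le
    have hq0 := Real.sqrt_pos.2 hN0
    rw [show s * (N : ℝ) = s * Real.sqrt N * Real.sqrt N by rw [mul_assoc, hq]]
    exact mul_le_mul_iff_left₀ hq0
  rw [e1]
  refine h.trans (le_of_eq ?_)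
  congr 1
  rw [mul_pow, Real.sq_sqrt hN0.le]
  simp
  field_simp

/-- Hoeffding's inequality for a product measure. -/
lemma hoeffding_pi {N : ℕ} (hN : 1 ≤ N) (μ : Fin N → Measure S)
    [∀ i, IsProbabilityMeasure (μ i)] {φ : S → ℝ} (hφ : Measurable φ) (hb : ∀ x, |φ x| ≤ 1)
    {s : ℝ} (hs : 0 ≤ s) :
    (Measure.pi μ) {x | s / Real.sqrt N < |empMean φ x - (1 / (N : ℝ)) * ∑ i, ∫ y, φ y ∂μ i|} ≤
      ENNReal.ofReal (2 * Real.exp (-s ^ 2 / 2)) := by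
  have h1 := hoeffding_pi_upper hN μ hφ hb hs
  have h2 := hoeffding_pi_upper hN μ hφ.neg (fun x => by simpa using hb x) hs
  rw [← ofReal_measureReal]
  apply ENNReal.ofReal_le_ofReal
  rw [two_mul]
  refine (measureReal_mono ?_).trans ((measureReal_union_le _ _).trans (add_le_add h1 h2))
  intro x hx
  have hneg : empMean (-φ) x - (1 / (N : ℝ)) * ∑ i, ∫ y, (-φ) y ∂μ i =
      -(empMean φ x - (1 / (N : ℝ)) * ∑ i, ∫ y, φ y ∂μ i) := by
    simp [empMean, integral_neg]
    ring
  simp only [mem_union, mem_ofPred_eq, hneg] at hx ⊢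
  rcases lt_abs.1 hx with h | h
  · exact Or.inl h.le
  · exact Or.inr h.le

/-- The product of finitely many Markov kernels. -/
def piKernel {V : Type*} [MeasurableSpace V] {N : ℕ} (μ : Fin N → Kernel V S)
    [∀ i, IsMarkovKernel (μ i)] : Kernel V (Fin N → S) where
  toFun v := Measure.pi (fun i => μ i v)
  measurable' := by
    refine Measurable.measure_of_isPiSystem_of_isProbabilityMeasure
      generateFrom_pi.symm isPiSystem_pi ?_
    rintro _ ⟨s, hs, rfl⟩
    simp only [Measure.pi_pi]
    refine Finset.measurable_prod _ fun i _ => ?_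
    exact Kernel.measurable_coe _ (hs i (mem_univ i))

lemma piKernel_apply {V : Type*} [MeasurableSpace V] {N : ℕ} (μ : Fin N → Kernel V S)
    [∀ i, IsMarkovKernel (μ i)] (v : V) : piKernel μ v = Measure.pi (fun i => μ i v) := rfl

instance {V : Type*} [MeasurableSpace V] {N : ℕ} (μ : Fin N → Kernel V S)
    [∀ i, IsMarkovKernel (μ i)] : IsMarkovKernel (piKernel μ) :=
  ⟨fun v => by rw [piKernel_apply]; infer_instance⟩

/-- A random variable with conditional law `η (U ω)` given a σ-algebra `m` for which `U` is
measurable has a joint law with `U` given by the composition product. -/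
lemma map_prodMk_eq_compProd {Ω V V' : Type*} {m mΩ : MeasurableSpace Ω} [MeasurableSpace V]
    [MeasurableSpace V'] {Pr : Measure Ω} [IsProbabilityMeasure Pr]
    (hm : m ≤ mΩ) {U : Ω → V} {W : Ω → V'} (hU : Measurable[m] U) (hW : Measurable W)
    (η : Kernel V V') [IsMarkovKernel η]
    (h : ∀ A, MeasurableSet A → Pr⟦W ⁻¹' A | m⟧ =ᵐ[Pr] fun ω => (η (U ω)).real A) :
    Pr.map (fun ω => (U ω, W ω)) = (Pr.map U).compProd η := by
  have hU' : Measurable U := hU.mono hm le_rfl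
  refine Measure.ext_prod fun {B A} hB hA => ?_
  rw [Measure.map_apply (hU'.prodMk hW) (hB.prod hA), Measure.compProd_apply_prod hB hA,
    setLIntegral_map hB (Kernel.measurable_coe _ hA) hU']
  have e1 : (fun ω => (U ω, W ω)) ⁻¹' B ×ˢ A = W ⁻¹' A ∩ U ⁻¹' B := by
    ext ω
    simp [and_comm]
  -- Rectangles determine the joint law; since `U ⁻¹' B` belongs to `m`, the conditional probability
  -- may be integrated over it.
  have h2 := setIntegral_condExp hm (f := (W ⁻¹' A).indicator fun _ => (1 : ℝ)) (μ := Pr)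
    (Integrable.indicator (integrable_const _) (hW hA)) (hU hB)
  rw [setIntegral_congr_ae (hU' hB) ((h A hA).mono fun ω hω _ => hω),
    integral_indicator_const _ (hW hA), smul_eq_mul, mul_one, measureReal_restrict_apply (hW hA)]
    at h2
  rw [e1, ← ofReal_measureReal, ← h2, ofReal_integral_eq_lintegral_ofReal]
  · refine lintegral_congr fun ω => ?_
    rw [ofReal_measureReal]
  · refine Integrable.of_mem_Icc 0 1 ?_ ?_
    · exact ((Kernel.measurable_coe η hA).comp hU').ennreal_toReal.aemeasurable
    · exact Filter.Eventually.of_forall fun ω => ⟨measureReal_nonneg, measureReal_le_one⟩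
  · exact Filter.Eventually.of_forall fun ω => measureReal_nonneg

/-- Hoeffding's inequality for variables drawn independently given the past. -/
lemma conditional_hoeffding {Ω V : Type*} {m mΩ : MeasurableSpace Ω} [MeasurableSpace V]
    {Pr : Measure Ω} [IsProbabilityMeasure Pr]
    (hm : m ≤ mΩ) {N : ℕ} (hN : 1 ≤ N) {U : Ω → V} {W : Ω → Fin N → S} (hU : Measurable[m] U)
    (hW : Measurable W) (μ : Fin N → Kernel V S) [∀ i, IsMarkovKernel (μ i)]
    (h : ∀ A, MeasurableSet A →
      Pr⟦W ⁻¹' A | m⟧ =ᵐ[Pr] fun ω => (Measure.pi fun i => μ i (U ω)).real A)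
    {φ : S → ℝ} (hφ : Measurable φ) (hb : ∀ x, |φ x| ≤ 1) {s : ℝ} (hs : 0 ≤ s) :
    Pr {ω | s / Real.sqrt N <
      |empMean φ (W ω) - (1 / (N : ℝ)) * ∑ i, ∫ y, φ y ∂μ i (U ω)|} ≤
      ENNReal.ofReal (2 * Real.exp (-s ^ 2 / 2)) := by
  have hU' : Measurable U := hU.mono hm le_rfl
  have hlaw := map_prodMk_eq_compProd hm hU hW (piKernel μ) h
  have hE : MeasurableSet {z : V × (Fin N → S) | s / Real.sqrt N <
      |empMean φ z.2 - (1 / (N : ℝ)) * ∑ i, ∫ y, φ y ∂μ i z.1|} := by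
    refine measurableSet_lt measurable_const (Measurable.abs ?_)
    refine ((measurable_empMean hφ).comp measurable_snd).sub (Measurable.const_mul ?_ _)
    refine Finset.measurable_sum _ fun i _ => ?_
    have := (hφ.stronglyMeasurable).integral_kernel (κ := μ i)
    exact this.measurable.comp measurable_fst
  have := Measurable.prodMk hU' hW
  have e := congrArg (fun ν => ν {z : V × (Fin N → S) | s / Real.sqrt N <
      |empMean φ z.2 - (1 / (N : ℝ)) * ∑ i, ∫ y, φ y ∂μ i z.1|}) hlaw
  simp only [Measure.map_apply this hE, Measure.compProd_apply hE] at e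
  have e2 : {ω | s / Real.sqrt N <
      |empMean φ (W ω) - (1 / (N : ℝ)) * ∑ i, ∫ y, φ y ∂μ i (U ω)|} =
      (fun ω => (U ω, W ω)) ⁻¹' {z : V × (Fin N → S) | s / Real.sqrt N <
      |empMean φ z.2 - (1 / (N : ℝ)) * ∑ i, ∫ y, φ y ∂μ i z.1|} := rfl
  rw [e2, e]
  have : IsProbabilityMeasure (Pr.map U) := Measure.isProbabilityMeasure_map hU'.aemeasurable
  calc _ ≤ ∫⁻ _, ENNReal.ofReal (2 * Real.exp (-s ^ 2 / 2)) ∂(Pr.map U) :=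
        lintegral_mono fun v => hoeffding_pi hN (fun i => μ i v) hφ hb hs
    _ = _ := by simp

end Concentration

/-! ### Propagation of concentration through jittering and resampling. -/

section SamplerConvergence

variable {S : Type*}

lemma weight_nonneg {N : ℕ} {G : S → ℝ} (hG : ∀ x, 0 < G x) (x : Fin N → S) (j : Fin N) :
    0 ≤ weight G x j :=
  div_nonneg (hG _).le (Finset.sum_nonneg fun _ _ => (hG _).le)

lemma sum_weight {N : ℕ} (hN : 1 ≤ N) {G : S → ℝ} (hG : ∀ x, 0 < G x) (x : Fin N → S) :
    ∑ j, weight G x j = 1 := by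
  have : NeZero N := ⟨by omega⟩
  have h : 0 < ∑ l, G (x l) := Finset.sum_pos (fun _ _ => hG _) Finset.univ_nonempty
  unfold weight
  rw [← Finset.sum_div, div_self h.ne']

/-- Reduces the error of self-normalized weights to concentration of a numerator and a denominator.
-/
lemma sum_weight_mul {N : ℕ} (hN : 1 ≤ N) {G : S → ℝ} (φ : S → ℝ) (x : Fin N → S) :
    ∑ j, weight G x j * φ (x j) = empMean (fun y => G y * φ y) x / empMean G x := by
  have : (0 : ℝ) < N := by exact_mod_cast hN
  simp only [weight, empMean, div_mul_eq_mul_div]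
  rw [← Finset.sum_div, one_mul, one_mul, div_div_div_cancel_right₀ this.ne']

/-- Because `|a₂ / a₁| ≤ 1`, only the deterministic denominator `b₁` appears in the bound, and no
lower bound on the random `a₁` is needed. -/
lemma abs_div_sub_div_le {a₁ a₂ b₁ b₂ δ : ℝ} (ha : 0 < a₁) (hb : 0 < b₁) (ha₂ : |a₂| ≤ a₁)
    (h₁ : |a₁ - b₁| ≤ δ) (h₂ : |a₂ - b₂| ≤ δ) : |a₂ / a₁ - b₂ / b₁| ≤ 2 * δ / b₁ := by
  have e : a₂ / a₁ - b₂ / b₁ = ((a₂ - b₂) - (a₂ / a₁) * (a₁ - b₁)) / b₁ := by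
    field_simp
    ring
  have h3 : |a₂ / a₁| ≤ 1 := by
    rw [abs_div, abs_of_pos ha]
    exact div_le_one_of_le₀ ha₂ ha.le
  rw [e, abs_div, abs_of_pos hb]
  gcongr
  calc |(a₂ - b₂) - (a₂ / a₁) * (a₁ - b₁)| ≤ |a₂ - b₂| + |(a₂ / a₁) * (a₁ - b₁)| := abs_sub _ _
    _ ≤ δ + 1 * δ := by
        rw [abs_mul]
        gcongr
    _ = 2 * δ := by ring

lemma abs_empMean_le {N : ℕ} {φ ψ : S → ℝ} (h : ∀ x, |φ x| ≤ ψ x) (x : Fin N → S) :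
    |empMean φ x| ≤ empMean ψ x := by
  unfold empMean
  rw [abs_mul, abs_of_nonneg (by positivity : (0 : ℝ) ≤ 1 / N)]
  gcongr
  exact (Finset.abs_sum_le_sum_abs _ _).trans (Finset.sum_le_sum fun i _ => h _)

lemma empMean_pos {N : ℕ} (hN : 1 ≤ N) {G : S → ℝ} (hG : ∀ x, 0 < G x) (x : Fin N → S) :
    0 < empMean G x := by
  have : NeZero N := ⟨by omega⟩
  have : (0 : ℝ) < N := by exact_mod_cast hN
  exact mul_pos (by positivity) (Finset.sum_pos (fun _ _ => hG _) Finset.univ_nonempty)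

variable [MeasurableSpace S]

/-- The kernel `x ↦ ∑_j w_j δ_{x_j}` that draws one particle from the weighted particles. -/
def resampleKernel (N : ℕ) {G : S → ℝ} (hG : Measurable G) : Kernel (Fin N → S) S where
  toFun x := ∑ j, ENNReal.ofReal (weight G x j) • Measure.dirac (x j)
  measurable' := by
    refine Measure.measurable_of_measurable_coe _ fun A hA => ?_
    simp only [Measure.coe_finsetSum, Finset.sum_apply, Measure.smul_apply, smul_eq_mul]
    refine Finset.measurable_sum _ fun j _ => Measurable.mul ?_ ?_
    · unfold weight
      fun_prop
    · exact (Measure.measurable_coe hA).comp (Measure.measurable_dirac.comp (measurable_pi_apply j))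

lemma resampleKernel_apply {N : ℕ} {G : S → ℝ} (hG : Measurable G) (x : Fin N → S) :
    resampleKernel N hG x = ∑ j, ENNReal.ofReal (weight G x j) • Measure.dirac (x j) := rfl

lemma isMarkovKernel_resampleKernel {N : ℕ} (hN : 1 ≤ N) {G : S → ℝ} (hG : Measurable G)
    (hG0 : ∀ x, 0 < G x) : IsMarkovKernel (resampleKernel N hG) := by
  refine ⟨fun x => ⟨?_⟩⟩
  rw [resampleKernel_apply]
  simp only [Measure.coe_finsetSum, Finset.sum_apply, Measure.smul_apply, smul_eq_mul,
    measure_univ, mul_one]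
  rw [← ENNReal.ofReal_sum_of_nonneg fun j _ => weight_nonneg hG0 x j, sum_weight hN hG0,
    ENNReal.ofReal_one]

lemma integral_resampleKernel {N : ℕ} {G : S → ℝ} (hG : Measurable G)
    (hG0 : ∀ x, 0 < G x) {φ : S → ℝ} (hφ : Measurable φ) (x : Fin N → S) :
    ∫ y, φ y ∂resampleKernel N hG x = ∑ j, weight G x j * φ (x j) := by
  rw [resampleKernel_apply, integral_finsetSum_measure]
  · refine Finset.sum_congr rfl fun j _ => ?_
    rw [integral_smul_measure, integral_dirac' _ _ hφ.stronglyMeasurable,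
      ENNReal.toReal_ofReal (weight_nonneg hG0 x j), smul_eq_mul]
  · intro j _
    refine Integrable.smul_measure ?_ ENNReal.ofReal_ne_top
    exact integrable_dirac' hφ.stronglyMeasurable (by simp)

/-- The empirical means of test functions bounded by one concentrate around their integrals with
respect to `μ`, at the rate `N^{-1/2}` and with sub-Gaussian tails, uniformly in the number of
particles. -/
def Concentrates {Ω : Type*} [MeasurableSpace Ω] (Pr : Measure Ω)
    (X : (N : ℕ) → Ω → Fin N → S) (μ : Measure S) : Prop :=
  ∃ A K : ℝ, 0 ≤ A ∧ 0 ≤ K ∧ ∀ N : ℕ, 1 ≤ N → ∀ φ : S → ℝ, Measurable φ → (∀ x, |φ x| ≤ 1) →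
    ∀ s : ℝ, 1 ≤ s → Pr {ω | A * (s / Real.sqrt N) < |empMean φ (X N ω) - ∫ y, φ y ∂μ|} ≤
      ENNReal.ofReal (K * Real.exp (-s ^ 2 / 2))

variable {Ω : Type*} [mΩ : MeasurableSpace Ω] {Pr : Measure Ω}

lemma concentrates_initial {X : (N : ℕ) → Ω → Fin N → S} {π₀ : Measure S} [IsProbabilityMeasure π₀]
    (hX : ∀ N, 1 ≤ N → Measurable (X N))
    (h : ∀ N, 1 ≤ N → Pr.map (X N) = Measure.pi (fun _ => π₀)) : Concentrates Pr X π₀ := by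
  refine ⟨1, 2, by norm_num, by norm_num, fun N hN φ hφ hb s hs => ?_⟩
  have hN0 : (0 : ℝ) < N := by exact_mod_cast hN
  have h1 := hoeffding_pi hN (fun _ => π₀) hφ hb (s := s) (by linarith)
  rw [← h N hN, Measure.map_apply (hX N hN)] at h1
  · convert h1 using 2
    ext ω
    simp only [mem_ofPred_eq, mem_preimage, one_mul, Finset.sum_const, Finset.card_univ,
      Fintype.card_fin, nsmul_eq_mul, one_div, inv_mul_cancel_left₀ hN0.ne']
  · exact measurableSet_lt measurable_const
      (((measurable_empMean hφ).sub measurable_const).abs)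

lemma abs_integral_kernel_sub_le {κ : ℕ → Kernel S S} [∀ N, IsMarkovKernel (κ N)] {c : ℝ}
    (hc : ∀ N : ℕ, 1 ≤ N → ∀ φ : S → ℝ, Measurable φ → ∀ b : ℝ, (∀ θ, |φ θ| ≤ b) →
      ∀ θ' : S, ∫ θ, |φ θ - φ θ'| ∂(κ N θ') ≤ c * b / Real.sqrt N)
    {N : ℕ} (hN : 1 ≤ N) {φ : S → ℝ} (hφ : Measurable φ) (hb : ∀ x, |φ x| ≤ 1) (x : S) :
    |∫ y, φ y ∂κ N x - φ x| ≤ |c| / Real.sqrt N := by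
  have hint : Integrable φ (κ N x) := Integrable.of_bound hφ.aestronglyMeasurable 1
    (Filter.Eventually.of_forall hb)
  have e : ∫ y, φ y ∂κ N x - φ x = ∫ y, (φ y - φ x) ∂κ N x := by
    rw [integral_sub hint (integrable_const _)]
    simp
  rw [e]
  refine (abs_integral_le_integral_abs).trans ((hc N hN φ hφ 1 hb x).trans ?_)
  rw [mul_one]
  gcongr
  exact le_abs_self c

variable [IsProbabilityMeasure Pr]

/-- The error splits into the conditional fluctuation (Hoeffding), the jittering bias, and the error
already present before jittering; these contribute `1`, `|c|` and `A` to the new constant. -/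
lemma Concentrates.jitter {κ : ℕ → Kernel S S} [∀ N, IsMarkovKernel (κ N)]
    (hκ : JitterCondition κ) {μ : Measure S} {X Y : (N : ℕ) → Ω → Fin N → S}
    (hX : Concentrates Pr X μ) {m : ℕ → MeasurableSpace Ω} (hm : ∀ N, 1 ≤ N → m N ≤ mΩ)
    (hXm : ∀ N, 1 ≤ N → Measurable[m N] (X N)) (hY : ∀ N, 1 ≤ N → Measurable (Y N))
    (h : ∀ N, 1 ≤ N → ∀ A : Set (Fin N → S), MeasurableSet A →
      Pr⟦Y N ⁻¹' A | m N⟧ =ᵐ[Pr] fun ω => (jitterLaw (κ N) (X N ω)).real A) :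
    Concentrates Pr Y μ := by
  obtain ⟨c, hc⟩ := hκ
  obtain ⟨A, K, hA, hK, hX⟩ := hX
  refine ⟨1 + |c| + A, 2 + K, by positivity, by positivity, fun N hN φ hφ hb s hs => ?_⟩
  have hN0 : (0 : ℝ) < N := by exact_mod_cast hN
  have hs0 : 0 ≤ s := by linarith
  have h1 := conditional_hoeffding (hm N hN) hN (hXm N hN) (hY N hN)
    (fun i => (κ N).comap (fun x : Fin N → S => x i) (measurable_pi_apply i)) (h N hN) hφ hb hs0
  have h2 := hX N hN φ hφ hb s hs
  rw [add_mul 2 K, ENNReal.ofReal_add (by positivity) (by positivity)]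
  refine (measure_mono ?_).trans ((measure_union_le _ _).trans (add_le_add h1 h2))
  intro ω hω
  by_contra hcon
  simp only [mem_union, mem_ofPred_eq, not_or, not_lt, Kernel.comap_apply] at hcon hω
  obtain ⟨h3, h4⟩ := hcon
  -- The bias does not depend on `s`; the restriction `1 ≤ s` allows it to be absorbed at level `s /
  -- √N`.
  have h5 : |(1 / (N : ℝ)) * ∑ i, ∫ y, φ y ∂κ N (X N ω i) - empMean φ (X N ω)| ≤
      |c| * (s / Real.sqrt N) := by
    unfold empMean
    rw [← mul_sub, ← Finset.sum_sub_distrib, abs_mul, abs_of_pos (by positivity : 0 < 1 / (N : ℝ))]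
    calc _ ≤ 1 / (N : ℝ) * ∑ i : Fin N, |c| / Real.sqrt N := by
          gcongr
          exact (Finset.abs_sum_le_sum_abs _ _).trans
            (Finset.sum_le_sum fun i _ => abs_integral_kernel_sub_le hc hN hφ hb _)
      _ = |c| * (1 / Real.sqrt N) := by
          simp
          field_simp
      _ ≤ _ := by gcongr
  have h6 := abs_sub_le (empMean φ (Y N ω)) ((1 / (N : ℝ)) * ∑ i, ∫ y, φ y ∂κ N (X N ω i))
    (∫ y, φ y ∂μ)
  have h7 := abs_sub_le ((1 / (N : ℝ)) * ∑ i, ∫ y, φ y ∂κ N (X N ω i)) (empMean φ (X N ω))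
    (∫ y, φ y ∂μ)
  rw [add_mul, add_mul] at hω
  linarith

/-- Conditional Hoeffding compares the new particles with the weighted mean, which is a ratio of
empirical means of `G * φ` and `G`. Concentration of both transfers to the ratio, at the cost of
dividing by the limiting normalization. -/
lemma Concentrates.resample {G : S → ℝ} (hG : Measurable G) (hG0 : ∀ x, 0 < G x)
    (hGb : ∃ C : ℝ, ∀ x, G x ≤ C) {μ ν : Measure S}
    (hμG : 0 < ∫ y, G y ∂μ)
    (hν : ∀ φ : S → ℝ, Measurable φ → ∫ y, φ y ∂ν = (∫ y, G y * φ y ∂μ) / ∫ y, G y ∂μ)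
    {X Y : (N : ℕ) → Ω → Fin N → S}
    (hY : Concentrates Pr Y μ) {m : ℕ → MeasurableSpace Ω} (hm : ∀ N, 1 ≤ N → m N ≤ mΩ)
    (hYm : ∀ N, 1 ≤ N → Measurable[m N] (Y N)) (hX : ∀ N, 1 ≤ N → Measurable (X N))
    (h : ∀ N, 1 ≤ N → ∀ A : Set (Fin N → S), MeasurableSet A →
      Pr⟦X N ⁻¹' A | m N⟧ =ᵐ[Pr] fun ω => (resampleLaw G (Y N ω)).real A) :
    Concentrates Pr X ν := by
  obtain ⟨C₀, hC₀⟩ := hGb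
  obtain ⟨C, hC, hC1⟩ : ∃ C : ℝ, (∀ x, G x ≤ C) ∧ 0 < C :=
    ⟨max C₀ 1, fun x => (hC₀ x).trans (le_max_left _ _), by positivity⟩
  obtain ⟨A, K, hA, hK, hY⟩ := hY
  set b := ∫ y, G y ∂μ with hbdef
  refine ⟨1 + 2 * (C * A) / b, 2 + (K + K), by positivity, by positivity,
    fun N hN φ hφ hb s hs => ?_⟩
  have hN0 : (0 : ℝ) < N := by exact_mod_cast hN
  have hs0 : 0 ≤ s := by linarith
  have hMk := isMarkovKernel_resampleKernel hN hG hG0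
  have h1 := conditional_hoeffding (hm N hN) hN (hYm N hN) (hX N hN)
    (fun _ => resampleKernel N hG) (h N hN) hφ hb hs0
  -- `Concentrates` only covers test functions bounded by one, hence the scaling by `C⁻¹`; it is
  -- undone in `hscale`.
  have h2 := hY N hN (fun y => C⁻¹ * G y) (by fun_prop) (fun y => by
    rw [abs_of_nonneg (mul_nonneg (by positivity) (hG0 y).le), inv_mul_le_iff₀ hC1, mul_one]
    exact hC y) s hs
  have h3 := hY N hN (fun y => C⁻¹ * (G y * φ y)) (by fun_prop) (fun y => by
    rw [abs_mul, abs_of_pos (inv_pos.2 hC1), inv_mul_le_iff₀ hC1, mul_one, abs_mul,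
      abs_of_pos (hG0 y)]
    exact (mul_le_of_le_one_right (hG0 y).le (hb y)).trans (hC y)) s hs
  rw [add_mul 2 (K + K), ENNReal.ofReal_add (by positivity) (by positivity), add_mul K K,
    ENNReal.ofReal_add (by positivity) (by positivity)]
  refine (measure_mono ?_).trans ((measure_union_le _ _).trans (add_le_add h1
    ((measure_union_le _ _).trans (add_le_add h2 h3))))
  intro ω hω
  by_contra hcon
  simp only [mem_union, mem_ofPred_eq, not_or, not_lt] at hcon hω
  obtain ⟨h4, h5, h6⟩ := hcon
  have hscale : ∀ ψ : S → ℝ, |empMean (fun y => C⁻¹ * ψ y) (Y N ω) - ∫ y, C⁻¹ * ψ y ∂μ| ≤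
      A * (s / Real.sqrt N) → |empMean ψ (Y N ω) - ∫ y, ψ y ∂μ| ≤ C * A * (s / Real.sqrt N) := by
    intro ψ hψ
    have e : empMean (fun y => C⁻¹ * ψ y) (Y N ω) - ∫ y, C⁻¹ * ψ y ∂μ =
        C⁻¹ * (empMean ψ (Y N ω) - ∫ y, ψ y ∂μ) := by
      rw [integral_const_mul, empMean, empMean, ← Finset.mul_sum]
      ring
    rw [e, abs_mul, abs_of_pos (inv_pos.2 hC1), inv_mul_le_iff₀ hC1] at hψ
    linarith
  have h7 := abs_div_sub_div_le (empMean_pos hN hG0 (Y N ω)) hμG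
    (abs_empMean_le (fun y => by
      rw [abs_mul, abs_of_pos (hG0 y)]
      exact mul_le_of_le_one_right (hG0 y).le (hb y)) (Y N ω)) (hscale _ h5) (hscale _ h6)
  rw [← hν φ hφ, ← sum_weight_mul hN] at h7
  simp only [integral_resampleKernel hG hG0 hφ] at h4
  have e4 : (1 / (N : ℝ)) * ∑ i : Fin N, ∑ j, weight G (Y N ω) j * φ (Y N ω j) =
      ∑ j, weight G (Y N ω) j * φ (Y N ω j) := by
    simp
    field_simp
  rw [e4] at h4
  have h8 := abs_sub_le (empMean φ (X N ω)) (∑ j, weight G (Y N ω) j * φ (Y N ω j))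
    (∫ y, φ y ∂ν)
  have e5 : 2 * (C * A * (s / Real.sqrt N)) / b = 2 * (C * A) / b * (s / Real.sqrt N) := by ring
  rw [e5] at h7
  rw [add_mul] at hω
  linarith

end SamplerConvergence

/-! ### The target measures and the induction over time. -/

section TargetFacts

variable {d : ℕ} {Θ : Set (EuclideanSpace ℝ (Fin d))}

lemma integral_pos_of_pos_of_bounded {S : Type*} [MeasurableSpace S] {μ : Measure S}
    [IsProbabilityMeasure μ] {G : S → ℝ} (hG : Measurable G) (hG0 : ∀ x, 0 < G x)
    (hGb : ∃ C : ℝ, ∀ x, G x ≤ C) : Integrable G μ ∧ 0 < ∫ y, G y ∂μ := by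
  obtain ⟨C, hC⟩ := hGb
  have hint : Integrable G μ := Integrable.of_mem_Icc 0 C hG.aemeasurable
    (Filter.Eventually.of_forall fun x => ⟨(hG0 x).le, hC x⟩)
  refine ⟨hint, ?_⟩
  rw [integral_pos_iff_support_of_nonneg (fun x => (hG0 x).le) hint]
  have : Function.support G = univ := by
    ext x
    simp [(hG0 x).ne']
  simp [this]

lemma isProbabilityMeasure_target {π₀ : Measure Θ} [IsProbabilityMeasure π₀] {G : ℕ → Θ → ℝ}
    (hG : ∀ t, Measurable (G t)) (hG0 : ∀ t x, 0 < G t x) {T : ℕ}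
    (hGb : ∀ t, 1 ≤ t → t ≤ T → ∃ C : ℝ, ∀ x, G t x ≤ C) :
    ∀ t ≤ T, IsProbabilityMeasure (target π₀ G t)
  | 0, _ => by unfold target; infer_instance
  | t + 1, ht => by
    have := isProbabilityMeasure_target (π₀ := π₀) hG hG0 hGb t (by omega)
    obtain ⟨hint, hpos⟩ := integral_pos_of_pos_of_bounded (μ := target π₀ G t) (hG (t + 1))
      (hG0 (t + 1)) (hGb (t + 1) (by omega) ht)
    rw [target, ← ofReal_integral_eq_lintegral_ofReal hint
      (Filter.Eventually.of_forall fun x => (hG0 _ x).le)]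
    refine ⟨?_⟩
    rw [Measure.smul_apply, withDensity_apply _ MeasurableSet.univ, setLIntegral_univ,
      ← ofReal_integral_eq_lintegral_ofReal hint
      (Filter.Eventually.of_forall fun x => (hG0 _ x).le), smul_eq_mul, ENNReal.inv_mul_cancel]
    · simpa using hpos
    · exact ENNReal.ofReal_ne_top

lemma integral_target_succ {π₀ : Measure Θ} {G : ℕ → Θ → ℝ}
    (hG : ∀ t, Measurable (G t)) (hG0 : ∀ t x, 0 < G t x) {t : ℕ}
    (hint : Integrable (G (t + 1)) (target π₀ G t)) (φ : Θ → ℝ) :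
    ∫ y, φ y ∂target π₀ G (t + 1) =
      (∫ y, G (t + 1) y * φ y ∂target π₀ G t) / ∫ y, G (t + 1) y ∂target π₀ G t := by
  rw [target, integral_smul_measure, ← ofReal_integral_eq_lintegral_ofReal hint
      (Filter.Eventually.of_forall fun x => (hG0 _ x).le), ENNReal.toReal_inv,
      ENNReal.toReal_ofReal (integral_nonneg fun x => (hG0 _ x).le),
      integral_withDensity_eq_integral_toReal_smul (by fun_prop)
        (Filter.Eventually.of_forall fun x => ENNReal.ofReal_lt_top), smul_eq_mul, div_eq_inv_mul]
  congr 1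
  refine integral_congr_ae (Filter.Eventually.of_forall fun x => ?_)
  simp only [ENNReal.toReal_ofReal (hG0 _ x).le, smul_eq_mul]

variable {Ω : Type*} [mΩ : MeasurableSpace Ω] {Pr : Measure Ω} [IsProbabilityMeasure Pr]

/-- Concentration of the particles of the sampler around the target measures. -/
theorem IsSamplerRun.concentrates {π₀ : Measure Θ} [IsProbabilityMeasure π₀] {G : ℕ → Θ → ℝ}
    (hG : ∀ t, Measurable (G t)) (hG0 : ∀ t x, 0 < G t x) {T : ℕ}
    (hGb : ∀ t, 1 ≤ t → t ≤ T → ∃ C : ℝ, ∀ x, G t x ≤ C)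
    {κ : ℕ → Kernel Θ Θ} [∀ N, IsMarkovKernel (κ N)] (hκ : JitterCondition κ)
    {X Y : (N : ℕ) → ℕ → Ω → Fin N → Θ}
    (hrun : ∀ N, 1 ≤ N → IsSamplerRun Pr N T π₀ (κ N) G (X N) (Y N)) :
    ∀ t ≤ T, Concentrates Pr (fun N => X N t) (target π₀ G t)
  | 0, _ => by
    rw [target]
    exact concentrates_initial (fun N hN => (hrun N hN).measurable_particles 0)
      (fun N hN => (hrun N hN).initial)
  | t + 1, ht => by
    have ih := IsSamplerRun.concentrates hG hG0 hGb hκ hrun t (by omega)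
    have := isProbabilityMeasure_target (π₀ := π₀) hG hG0 hGb t (by omega)
    obtain ⟨hint, hpos⟩ := integral_pos_of_pos_of_bounded (μ := target π₀ G t) (hG (t + 1))
      (hG0 (t + 1)) (hGb (t + 1) (by omega) ht)
    have hhist : ∀ N, 1 ≤ N → history (X N) (Y N) t ≤ mΩ := fun N hN => by
      refine sup_le (iSup₂_le fun s _ => ?_) (iSup₂_le fun s _ => ?_)
      · exact ((hrun N hN).measurable_particles s).comap_le
      · exact ((hrun N hN).measurable_jittered s).comap_le
    have hJ : Concentrates Pr (fun N => Y N (t + 1)) (target π₀ G t) :=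
      ih.jitter hκ (m := fun N => history (X N) (Y N) t) hhist
        (fun N hN => Measurable.of_comap_le ((le_iSup₂_of_le (f := fun s _ =>
          MeasurableSpace.comap (X N s) inferInstance) t (by simp) le_rfl).trans le_sup_left))
        (fun N hN => (hrun N hN).measurable_jittered _)
        (fun N hN => (hrun N hN).jitter t (by omega))
    exact hJ.resample (hG (t + 1)) (hG0 (t + 1)) (hGb (t + 1) (by omega) ht) hpos
      (fun φ _ => integral_target_succ hG hG0 hint φ)
      (m := fun N => history (X N) (Y N) t ⊔ MeasurableSpace.comap (Y N (t + 1)) inferInstance)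
      (fun N hN => sup_le (hhist N hN) ((hrun N hN).measurable_jittered _).comap_le)
      (fun N hN => Measurable.of_comap_le le_sup_right)
      (fun N hN => (hrun N hN).measurable_particles _)
      (fun N hN => (hrun N hN).resample t (by omega))

end TargetFacts

/-! ### Lipschitz, moment and bias estimates for the smoothing kernel. -/

section SmoothingKernel

variable {d : ℕ}

lemma mixedDeriv_empty (g : EuclideanSpace ℝ (Fin d) → ℝ) : mixedDeriv ∅ g = g := by
  simp [mixedDeriv, multiIndex, iterPderiv]

lemma multiIndex_singleton (i : Fin d) : multiIndex {i} = [i] := by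
  simp only [multiIndex, Finset.mem_singleton]
  rw [List.filter_eq, List.count_eq_one_of_mem (List.nodup_finRange d) (List.mem_finRange i)]
  rfl

lemma mixedDeriv_singleton (i : Fin d) (g : EuclideanSpace ℝ (Fin d) → ℝ) :
    mixedDeriv {i} g = pderiv i g := by
  rw [mixedDeriv, multiIndex_singleton]
  rfl

lemma sum_smul_single (v : EuclideanSpace ℝ (Fin d)) :
    ∑ i, v i • EuclideanSpace.single i (1 : ℝ) = v := by
  ext j
  simp [Pi.single_apply]

lemma norm_le_sum_abs (v : EuclideanSpace ℝ (Fin d)) : ‖v‖ ≤ ∑ i, |v i| := by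
  conv_lhs => rw [← sum_smul_single v]
  refine (norm_sum_le _ _).trans (le_of_eq (Finset.sum_congr rfl fun i _ => ?_))
  rw [norm_smul]
  simp

/-- Mean value inequality in a direction. -/
lemma abs_sub_le_of_lineDeriv_le {E : Type*} [NormedAddCommGroup E] [NormedSpace ℝ E] {g : E → ℝ}
    {v : E} (hg : ∀ x, LineDifferentiableAt ℝ g x v) {C : ℝ} (hC : ∀ x, |lineDeriv ℝ g x v| ≤ C)
    (x : E) (t : ℝ) : |g (x + t • v) - g x| ≤ C * |t| := by
  have hd : ∀ r : ℝ, HasDerivAt (fun r : ℝ => g (x + r • v)) (lineDeriv ℝ g (x + r • v) v) r := by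
    intro r
    have h := (hg (x + r • v)).hasLineDerivAt
    unfold HasLineDerivAt at h
    have h2 := HasDerivAt.comp_add_const (x := r) (-r) (f := fun t : ℝ => g (x + r • v + t • v))
      (f' := lineDeriv ℝ g (x + r • v) v) (by simpa using h)
    refine h2.congr_of_eventuallyEq (Filter.Eventually.of_forall fun u => ?_)
    simp only [add_smul, neg_smul]
    congr 1
    abel
  have := Convex.norm_image_sub_le_of_norm_hasDerivWithin_le (s := univ) (C := C)
    (f := fun r : ℝ => g (x + r • v)) (fun r _ => (hd r).hasDerivWithinAt)
    (fun r _ => hC _) convex_univ (mem_univ 0) (mem_univ t)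
  simpa using this

variable {k : EuclideanSpace ℝ (Fin d) → ℝ}

lemma IsSmoothingKernel.continuous (hk : IsSmoothingKernel k) : Continuous k := by
  have := hk.deriv_continuous ∅
  rwa [mixedDeriv_empty] at this

lemma IsSmoothingKernel.exists_bound (hk : IsSmoothingKernel k) :
    ∃ C : ℝ, 0 < C ∧ ∀ x, |k x| ≤ C := by
  obtain ⟨C, hC⟩ := hk.deriv_bounded ∅
  rw [mixedDeriv_empty] at hC
  exact ⟨max C 1, by positivity, fun x => (hC x).trans (le_max_left _ _)⟩

/-- The singleton multi-indices bound each partial derivative; moving from `y` to `x` one coordinate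
at a time and applying the mean value inequality at each move sums these bounds. -/
lemma IsSmoothingKernel.exists_lipschitz (hk : IsSmoothingKernel k) :
    ∃ L : ℝ, 0 ≤ L ∧ ∀ x y, |k x - k y| ≤ L * ‖x - y‖ := by
  choose C hC using fun i : Fin d => hk.deriv_bounded {i}
  have hstep : ∀ i x (t : ℝ), |k (x + t • EuclideanSpace.single i 1) - k x| ≤ C i * |t| := by
    intro i x t
    refine abs_sub_le_of_lineDeriv_le (fun z => ?_) (fun z => ?_) x t
    · have := hk.deriv_exists {i}
      rw [MixedDerivExists, multiIndex_singleton] at this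
      exact this.2 z (mem_univ z)
    · have := hC i z
      rwa [mixedDeriv_singleton] at this
  have hsum : ∀ (x v : EuclideanSpace ℝ (Fin d)) (s : Finset (Fin d)),
      |k (x + ∑ i ∈ s, v i • EuclideanSpace.single i 1) - k x| ≤ ∑ i ∈ s, C i * |v i| := by
    intro x v s
    induction s using Finset.induction_on with
    | empty => simp
    | insert i s his ih =>
      rw [Finset.sum_insert his, Finset.sum_insert his, add_comm (v i • _), ← add_assoc]
      refine (abs_sub_le _ (k (x + ∑ i ∈ s, v i • EuclideanSpace.single i 1)) _).trans ?_
      exact add_le_add (hstep _ _ _) ih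
  have hC0 : ∀ i, 0 ≤ C i := fun i => (abs_nonneg _).trans (hC i 0)
  refine ⟨∑ i, C i, Finset.sum_nonneg fun i _ => hC0 i, fun x y => ?_⟩
  have h := hsum y (x - y) Finset.univ
  rw [sum_smul_single, add_sub_cancel] at h
  refine h.trans ?_
  rw [Finset.sum_mul]
  refine Finset.sum_le_sum fun i _ => mul_le_mul_of_nonneg_left ?_ (hC0 i)
  have := PiLp.norm_apply_le (x - y) i
  simpa using this

lemma IsSmoothingKernel.integrable (hk : IsSmoothingKernel k) : Integrable k :=
  integrable_of_integral_eq_one hk.integral_eq_one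

/-- Follows from `‖x‖ ≤ 1 + ‖x‖ ^ 2`; this first absolute moment is the constant in the smoothing
bias. -/
lemma IsSmoothingKernel.integrable_norm_mul (hk : IsSmoothingKernel k) :
    Integrable (fun x => ‖x‖ * k x) := by
  refine Integrable.mono' (hk.integrable.add hk.second_moment)
    (continuous_norm.mul hk.continuous).aestronglyMeasurable
    (Filter.Eventually.of_forall fun x => ?_)
  have := hk.nonneg x
  rw [Real.norm_of_nonneg (by positivity), Pi.add_apply]
  nlinarith [sq_nonneg (‖x‖ - 1)]

lemma integral_scaledKernel_mul {h : ℝ} (hh : 0 < h) (q : EuclideanSpace ℝ (Fin d) → ℝ)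
    (x : EuclideanSpace ℝ (Fin d)) :
    ∫ y, scaledKernel k h (x - y) * q y = ∫ u, k u * q (x - h • u) := by
  have h1 := integral_sub_left_eq_self (fun z => scaledKernel k h z * q (x - z)) volume x
  simp only [sub_sub_cancel] at h1
  have h2 := Measure.integral_comp_smul volume (fun z => scaledKernel k h z * q (x - z)) h
  rw [finrank_euclideanSpace_fin, abs_of_pos (by positivity), smul_eq_mul] at h2
  rw [h1, ← mul_right_inj' (by positivity : (h ^ d)⁻¹ ≠ 0), ← h2, ← integral_const_mul]
  refine integral_congr_ae (Filter.Eventually.of_forall fun u => ?_)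
  simp only [scaledKernel, smul_smul, inv_mul_cancel₀ hh.ne', one_smul, mul_assoc]

/-- One-sided bias bound for kernel smoothing. -/
lemma IsSmoothingKernel.integral_scaledKernel_mul_le (hk : IsSmoothingKernel k) {h : ℝ}
    (hh : 0 < h) {q : EuclideanSpace ℝ (Fin d) → ℝ} (hq : Measurable q) {Q : ℝ}
    (hqb : ∀ y, |q y| ≤ Q) {x : EuclideanSpace ℝ (Fin d)} {a L : ℝ}
    (hL : ∀ y, q y ≤ a + L * ‖x - y‖) :
    ∫ y, scaledKernel k h (x - y) * q y ≤ a + L * (∫ u, ‖u‖ * k u) * h := by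
  rw [integral_scaledKernel_mul hh]
  calc ∫ u, k u * q (x - h • u) ≤ ∫ u, (a * k u + (L * h) * (‖u‖ * k u)) := by
        refine integral_mono (hk.integrable.mul_bdd (c := Q) ?_ ?_)
          ((hk.integrable.const_mul a).add (hk.integrable_norm_mul.const_mul _)) fun u => ?_
        · exact (hq.comp (by fun_prop)).aestronglyMeasurable
        · exact Filter.Eventually.of_forall fun u => hqb _
        · have h1 := mul_le_mul_of_nonneg_left (hL (x - h • u)) (hk.nonneg u)
          rw [sub_sub_cancel, norm_smul, Real.norm_of_nonneg hh.le] at h1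
          simp only
          linarith
    _ = _ := by
        rw [integral_add (hk.integrable.const_mul a) (hk.integrable_norm_mul.const_mul _),
          integral_const_mul, integral_const_mul, hk.integral_eq_one]
        ring

lemma abs_scaledKernel_inv_le {C : ℝ} (hC : ∀ x, |k x| ≤ C) (H : ℕ)
    (x : EuclideanSpace ℝ (Fin d)) : |scaledKernel k (H : ℝ)⁻¹ x| ≤ (H : ℝ) ^ d * C := by
  rw [scaledKernel, inv_pow, inv_inv, inv_inv, abs_mul, abs_of_nonneg (by positivity)]
  gcongr
  exact hC _

lemma abs_scaledKernel_inv_sub_le {L : ℝ} (hL : ∀ x y, |k x - k y| ≤ L * ‖x - y‖) (H : ℕ)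
    (x y : EuclideanSpace ℝ (Fin d)) :
    |scaledKernel k (H : ℝ)⁻¹ x - scaledKernel k (H : ℝ)⁻¹ y| ≤
      (H : ℝ) ^ (d + 1) * L * ‖x - y‖ := by
  rw [scaledKernel, scaledKernel, inv_pow, inv_inv, inv_inv, ← mul_sub, abs_mul,
    abs_of_nonneg (by positivity)]
  calc (H : ℝ) ^ d * |k ((H : ℝ) • x) - k ((H : ℝ) • y)|
      ≤ (H : ℝ) ^ d * (L * ‖(H : ℝ) • x - (H : ℝ) • y‖) := by
        gcongr
        exact hL _ _
    _ = _ := by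
        rw [← smul_sub, norm_smul]
        simp
        ring

lemma measurable_scaledKernel (hk : IsSmoothingKernel k) (h : ℝ) :
    Measurable (scaledKernel k h) := by
  have := hk.continuous.measurable
  unfold scaledKernel
  fun_prop

end SmoothingKernel

/-! ### Nets of `Θ` and masses of small balls. -/

section Geometry

variable {d : ℕ} {Θ : Set (EuclideanSpace ℝ (Fin d))}

lemma measurable_indicator_of_subtype {p : EuclideanSpace ℝ (Fin d) → ℝ} (hΘ : MeasurableSet Θ)
    (hpm : Measurable fun θ : Θ => p θ) : Measurable (Θ.indicator p) := by
  refine measurable_of_measurable_union_cover Θ Θᶜ hΘ hΘ.compl (union_compl_self Θ).ge ?_ ?_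
  · simpa using hpm
  · convert! (measurable_const : Measurable fun _ : (Θᶜ : Set _) => (0 : ℝ)) using 2 with y
    exact indicator_of_notMem y.2 p

/-- Integrals with respect to a measure on `Θ` with a density. -/
lemma IsDensity.integral_eq {μ : Measure Θ} {p : EuclideanSpace ℝ (Fin d) → ℝ}
    (hΘ : MeasurableSet Θ) (hp : IsDensity μ p) (hpm : Measurable fun θ : Θ => p θ)
    (φ : EuclideanSpace ℝ (Fin d) → ℝ) :
    ∫ θ : Θ, φ θ ∂μ = ∫ y, φ y * Θ.indicator p y := by
  rw [hp.2, integral_withDensity_eq_integral_toReal_smul hpm.ennreal_ofReal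
    (Filter.Eventually.of_forall fun x => ENNReal.ofReal_lt_top),
    integral_congr_ae (g := fun θ : Θ => (fun y => φ y * p y) θ)
    (Filter.Eventually.of_forall fun θ => by
      simp [ENNReal.toReal_ofReal (hp.1 θ θ.2), mul_comm]),
    integral_subtype_comap hΘ (fun y => φ y * p y), ← integral_indicator hΘ]
  refine integral_congr_ae (Filter.Eventually.of_forall fun y => ?_)
  by_cases hy : y ∈ Θ <;> simp [hy]

/-- A compact subset of `ℝ^d` has nets of size `O(N^d)` at scale `O(1/N)`. -/
lemma exists_finite_net (hΘ : IsCompact Θ) :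
    ∃ C : ℝ, 0 ≤ C ∧ ∀ N : ℕ, 1 ≤ N → ∃ t : Finset (EuclideanSpace ℝ (Fin d)),
      (t.card : ℝ) ≤ C * (N : ℝ) ^ d ∧ ∀ x ∈ Θ, ∃ y ∈ t, ‖x - y‖ ≤ C / N := by
  obtain ⟨R₀, hR₀⟩ := hΘ.isBounded.exists_norm_le
  obtain ⟨R, hR⟩ := exists_nat_ge R₀
  -- The net is the grid `ℤ^d / N` within the cube of half-side `R`: `(2 * R + 1) ^ d` serves the
  -- cardinality, and `d` the distance to the point obtained by taking floors in each coordinate.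
  refine ⟨max ((2 * R + 1) ^ d) d, by positivity, fun N hN => ?_⟩
  have hN0 : (0 : ℝ) < N := by exact_mod_cast hN
  have hN1 : (1 : ℝ) ≤ N := by exact_mod_cast hN
  let F : (Fin d → ℤ) → EuclideanSpace ℝ (Fin d) := fun z => WithLp.toLp 2 fun i => (z i : ℝ) / N
  refine ⟨(Fintype.piFinset fun _ : Fin d => Finset.Icc (-((R * N : ℕ) : ℤ)) (R * N : ℕ)).image F,
    ?_, fun x hx => ?_⟩
  · calc _ ≤ (((Fintype.piFinset fun _ : Fin d =>
          Finset.Icc (-((R * N : ℕ) : ℤ)) (R * N : ℕ)).card : ℕ) : ℝ) := by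
          exact_mod_cast Finset.card_image_le
      _ = (2 * (R * N) + 1 : ℝ) ^ d := by
          rw [Fintype.card_piFinset, Finset.prod_const, Int.card_Icc, Finset.card_univ,
            Fintype.card_fin]
          have : ((R * N : ℕ) + 1 - (-((R * N : ℕ) : ℤ))).toNat = 2 * (R * N) + 1 := by omega
          rw [this]
          push_cast
          ring
      _ ≤ ((2 * R + 1) * N : ℝ) ^ d := by
          gcongr
          nlinarith
      _ ≤ _ := by
          rw [mul_pow]
          gcongr
          exact le_max_left _ _
  · refine ⟨F fun i => ⌊x i * N⌋, Finset.mem_image_of_mem _ ?_, ?_⟩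
    · rw [Fintype.mem_piFinset]
      intro i
      have h1 : |x i| ≤ R := by
        have := PiLp.norm_apply_le x i
        rw [Real.norm_eq_abs] at this
        exact this.trans ((hR₀ x hx).trans hR)
      obtain ⟨h2, h3⟩ := abs_le.1 h1
      rw [Finset.mem_Icc]
      constructor
      · rw [Int.le_floor]
        push_cast
        nlinarith
      · rw [Int.floor_le_iff]
        push_cast
        nlinarith
    · refine (norm_le_sum_abs _).trans ?_
      calc _ ≤ ∑ i : Fin d, 1 / (N : ℝ) := by
            refine Finset.sum_le_sum fun i _ => ?_
            have e : (x - F fun i => ⌊x i * N⌋) i = (x i * N - ⌊x i * N⌋) / N := by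
              simp only [F, PiLp.sub_apply]
              field_simp
            rw [e, abs_div, abs_of_pos hN0]
            gcongr
            rw [abs_of_nonneg (by linarith [Int.floor_le (x i * N)])]
            linarith [Int.lt_floor_add_one (x i * N)]
        _ = d / N := by
            simp
            field_simp
        _ ≤ _ := by
            gcongr
            exact le_max_right _ _

/-- Lower bound on the mass of small balls under a density bounded below. -/
lemma IsDensity.le_integral_ball {μ : Measure Θ} {p : EuclideanSpace ℝ (Fin d) → ℝ}
    (hΘ : MeasurableSet Θ) (hp : IsDensity μ p) (hpm : Measurable fun θ : Θ => p θ)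
    {a : ℝ} (hpb : ∀ θ ∈ Θ, a ≤ p θ) {Q : ℝ} (hpQ : ∀ θ ∈ Θ, p θ ≤ Q)
    {x : EuclideanSpace ℝ (Fin d)} {r : ℝ} (hr : 0 < r) (hball : Metric.ball x r ⊆ Θ) :
    a * (volume.real (Metric.ball (0 : EuclideanSpace ℝ (Fin d)) 1)) * r ^ d ≤
      ∫ θ : Θ, (Metric.ball x r).indicator 1 (θ : EuclideanSpace ℝ (Fin d)) ∂μ := by
  rw [hp.integral_eq hΘ hpm]
  have hv : volume.real (Metric.ball x r) =
      r ^ d * volume.real (Metric.ball (0 : EuclideanSpace ℝ (Fin d)) 1) := by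
    rw [measureReal_def, Measure.addHaar_ball_of_pos _ _ hr, finrank_euclideanSpace_fin,
      ENNReal.toReal_mul, ENNReal.toReal_ofReal (by positivity), measureReal_def]
  have e : ∀ y, (Metric.ball x r).indicator (1 : EuclideanSpace ℝ (Fin d) → ℝ) y * Θ.indicator p y =
      (Metric.ball x r).indicator (Θ.indicator p) y := by
    intro y
    by_cases hy : y ∈ Metric.ball x r <;> simp [hy]
  simp_rw [e]
  rw [integral_indicator Metric.isOpen_ball.measurableSet]
  have hm : Measurable (Θ.indicator p) := measurable_indicator_of_subtype hΘ hpm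
  calc _ = ∫ _ in Metric.ball x r, a := by
        rw [setIntegral_const, hv, smul_eq_mul]
        ring
    _ ≤ _ := by
        refine setIntegral_mono_on (integrableOn_const measure_ball_lt_top.ne) ?_
          Metric.isOpen_ball.measurableSet fun y hy => ?_
        · refine Measure.integrableOn_of_bounded (M := max |a| |Q|) measure_ball_lt_top.ne
            hm.aestronglyMeasurable (Filter.Eventually.of_forall fun y => ?_)
          by_cases hy : y ∈ Θ
          · simp only [hy, indicator_of_mem, Real.norm_eq_abs]
            exact abs_le_max_abs_abs (hpb y hy) (hpQ y hy)
          · simp [hy]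
        · rw [indicator_of_mem (hball hy)]
          exact hpb y (hball hy)

end Geometry

/-! ### Uniform error of the density estimator and its maximizing particle. -/

section KernelDensityEstimation

variable {d : ℕ} {Θ : Set (EuclideanSpace ℝ (Fin d))} {Ω : Type*} [MeasurableSpace Ω]
  {Pr : Measure Ω}

lemma abs_empMean_sub_empMean_le {S : Type*} {N : ℕ} (hN : 1 ≤ N) {φ ψ : S → ℝ} {c : ℝ}
    (h : ∀ x, |φ x - ψ x| ≤ c) (x : Fin N → S) : |empMean φ x - empMean ψ x| ≤ c := by
  have hN0 : (0 : ℝ) < N := by exact_mod_cast hN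
  have e : empMean φ x - empMean ψ x = empMean (fun y => φ y - ψ y) x := by
    simp only [empMean, Finset.sum_sub_distrib, mul_sub]
  rw [e]
  refine (abs_empMean_le h x).trans (le_of_eq ?_)
  simp only [empMean, Finset.sum_const, Finset.card_univ, Fintype.card_fin, nsmul_eq_mul]
  field_simp

lemma abs_integral_sub_integral_le {S : Type*} [MeasurableSpace S] {μ : Measure S}
    [IsProbabilityMeasure μ] {φ ψ : S → ℝ} (hφ : Integrable φ μ) (hψ : Integrable ψ μ) {c : ℝ}
    (h : ∀ x, |φ x - ψ x| ≤ c) : |∫ x, φ x ∂μ - ∫ x, ψ x ∂μ| ≤ c := by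
  rw [← integral_sub hφ hψ]
  have := norm_integral_le_of_norm_le_const (μ := μ) (f := fun x => φ x - ψ x)
    (Filter.Eventually.of_forall h)
  simpa using this

/-- Uniform concentration of the kernel density estimator around its mean field limit. -/
theorem Concentrates.uniform_scaledKernel {μ : Measure Θ} [IsProbabilityMeasure μ]
    {X : (N : ℕ) → Ω → Fin N → Θ} (hX : Concentrates Pr X μ) (hΘ : IsCompact Θ)
    {k : EuclideanSpace ℝ (Fin d) → ℝ} (hk : IsSmoothingKernel k) :
    ∃ D K : ℝ, 0 ≤ D ∧ 0 ≤ K ∧ ∀ N : ℕ, 1 ≤ N → ∀ H : ℕ, 1 ≤ H →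
      (H : ℝ) ^ (d + 1) ≤ Real.sqrt N → ∀ s : ℝ, 1 ≤ s →
      Pr {ω | ∃ θ ∈ Θ, D * (s / H) <
        |empMean (fun y : Θ => scaledKernel k (H : ℝ)⁻¹ (θ - y)) (X N ω) -
          ∫ y : Θ, scaledKernel k (H : ℝ)⁻¹ (θ - y) ∂μ|} ≤
      ENNReal.ofReal (K * (N : ℝ) ^ d * Real.exp (-s ^ 2 / 2)) := by
  obtain ⟨A, K, hA, hK, hX⟩ := hX
  obtain ⟨C, hC, hnet⟩ := exists_finite_net hΘ
  obtain ⟨B, hB, hkB⟩ := hk.exists_bound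
  obtain ⟨L, hL, hkL⟩ := hk.exists_lipschitz
  -- `B * A` is the fluctuation at a net point; `L * C` is paid twice, in the empirical mean and in
  -- the integral, for moving to that net point.
  refine ⟨B * A + 2 * (L * C), C * K, by positivity, by positivity,
    fun N hN H hH hHN s hs => ?_⟩
  obtain ⟨t, htcard, ht⟩ := hnet N hN
  have hN0 : (0 : ℝ) < N := by exact_mod_cast hN
  have hH0 : (0 : ℝ) < H := by exact_mod_cast hH
  have hH1 : (1 : ℝ) ≤ H := by exact_mod_cast hH
  have hsq : 0 < Real.sqrt N := Real.sqrt_pos.2 hN0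
  set Φ : EuclideanSpace ℝ (Fin d) → Θ → ℝ := fun x y => scaledKernel k (H : ℝ)⁻¹ (x - y) with hΦ
  have hΦm : ∀ x, Measurable (Φ x) := fun x =>
    (measurable_scaledKernel hk _).comp (measurable_const.sub measurable_subtype_coe)
  have hΦb : ∀ x y, |Φ x y| ≤ (H : ℝ) ^ d * B := fun x y => abs_scaledKernel_inv_le hkB H _
  have hΦi : ∀ x, Integrable (Φ x) μ := fun x => Integrable.of_bound
    (hΦm x).aestronglyMeasurable _ (Filter.Eventually.of_forall (hΦb x))
  set b : ℝ := (H : ℝ) ^ d * B with hb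
  have hb0 : 0 < b := by positivity
  have hbad : ∀ x, Pr {ω | A * (s / Real.sqrt N) <
      |empMean (fun y => b⁻¹ * Φ x y) (X N ω) - ∫ y, b⁻¹ * Φ x y ∂μ|} ≤
      ENNReal.ofReal (K * Real.exp (-s ^ 2 / 2)) := fun x =>
    hX N hN _ ((hΦm x).const_mul _) (fun y => by
      rw [abs_mul, abs_of_pos (inv_pos.2 hb0), inv_mul_le_iff₀ hb0, mul_one]
      exact hΦb x y) s hs
  calc _ ≤ Pr (⋃ x ∈ t, {ω | A * (s / Real.sqrt N) <
      |empMean (fun y => b⁻¹ * Φ x y) (X N ω) - ∫ y, b⁻¹ * Φ x y ∂μ|}) := by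
        refine measure_mono ?_
        rintro ω ⟨θ, hθ, hω⟩
        by_contra hcon
        simp only [mem_iUnion, mem_ofPred_eq, not_exists, not_lt] at hcon
        obtain ⟨y, hyt, hy⟩ := ht θ hθ
        have h1 := hcon y hyt
        have e : empMean (fun z => b⁻¹ * Φ y z) (X N ω) - ∫ z, b⁻¹ * Φ y z ∂μ =
            b⁻¹ * (empMean (Φ y) (X N ω) - ∫ z, Φ y z ∂μ) := by
          rw [integral_const_mul, empMean, empMean, ← Finset.mul_sum]
          ring
        rw [e, abs_mul, abs_of_pos (inv_pos.2 hb0), inv_mul_le_iff₀ hb0] at h1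
        -- The bandwidth balance: a kernel of height of order `H ^ d` fluctuates at scale `H ^ d /
        -- √N`, which is at most `1 / H`.
        have h2 : b * (A * (s / Real.sqrt N)) ≤ B * A * (s / H) := by
          have : (H : ℝ) ^ d / Real.sqrt N ≤ 1 / H := by
            rw [div_le_div_iff₀ hsq hH0]
            linarith [pow_succ (H : ℝ) d]
          calc b * (A * (s / Real.sqrt N)) = B * A * s * ((H : ℝ) ^ d / Real.sqrt N) := by
                rw [hb]
                ring
            _ ≤ B * A * s * (1 / H) := by gcongr
            _ = _ := by ring
        have h3 : (H : ℝ) ^ (d + 1) * L * (C / N) ≤ L * C * (s / H) := by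
          have hHsq : (H : ℝ) ≤ Real.sqrt N := (le_self_pow₀ hH1 (by omega)).trans hHN
          have : (H : ℝ) ^ (d + 1) / N ≤ 1 / H := by
            rw [div_le_div_iff₀ hN0 hH0, one_mul]
            calc (H : ℝ) ^ (d + 1) * H ≤ Real.sqrt N * Real.sqrt N := by gcongr
              _ = N := Real.mul_self_sqrt hN0.le
          calc (H : ℝ) ^ (d + 1) * L * (C / N) = L * C * ((H : ℝ) ^ (d + 1) / N) := by ring
            _ ≤ L * C * (1 / H) := by gcongr
            _ ≤ _ := by gcongr
        have h4 : ∀ z, |Φ θ z - Φ y z| ≤ L * C * (s / H) := fun z => by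
          refine (abs_scaledKernel_inv_sub_le hkL H _ _).trans (le_trans ?_ h3)
          rw [sub_sub_sub_cancel_right]
          gcongr
        have h5 := abs_empMean_sub_empMean_le hN h4 (X N ω)
        have h6 := abs_integral_sub_integral_le (hΦi θ) (hΦi y) h4
        rw [abs_sub_comm] at h6
        have h7 := abs_sub_le (empMean (Φ θ) (X N ω)) (empMean (Φ y) (X N ω)) (∫ z, Φ θ z ∂μ)
        have h8 := abs_sub_le (empMean (Φ y) (X N ω)) (∫ z, Φ y z ∂μ) (∫ z, Φ θ z ∂μ)
        rw [add_mul] at hω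
        linarith
    _ ≤ ∑ x ∈ t, ENNReal.ofReal (K * Real.exp (-s ^ 2 / 2)) :=
        (measure_biUnion_finset_le _ _).trans (Finset.sum_le_sum fun x _ => hbad x)
    _ = ENNReal.ofReal (t.card * (K * Real.exp (-s ^ 2 / 2))) := by
        rw [Finset.sum_const, nsmul_eq_mul, ENNReal.ofReal_mul (p := (t.card : ℝ)) (by positivity),
          ENNReal.ofReal_natCast]
    _ ≤ _ := by
        refine ENNReal.ofReal_le_ofReal ?_
        calc _ ≤ C * (N : ℝ) ^ d * (K * Real.exp (-s ^ 2 / 2)) := by gcongr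
          _ = _ := by ring

/-- With high probability there are particles close to an interior point. -/
theorem Concentrates.exists_mem_ball (hd : 1 ≤ d) {μ : Measure Θ}
    {X : (N : ℕ) → Ω → Fin N → Θ} (hX : Concentrates Pr X μ) (hΘ : MeasurableSet Θ)
    {p : EuclideanSpace ℝ (Fin d) → ℝ} (hp : IsDensity μ p) (hpm : Measurable fun θ : Θ => p θ)
    {a Q : ℝ} (ha : 0 < a) (hpa : ∀ θ ∈ Θ, a ≤ p θ) (hpQ : ∀ θ ∈ Θ, p θ ≤ Q)
    (x₀ : EuclideanSpace ℝ (Fin d)) :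
    ∃ C K : ℝ, 0 < C ∧ 0 ≤ K ∧ ∀ N : ℕ, 1 ≤ N → ∀ H : ℕ, 1 ≤ H →
      (H : ℝ) ^ (d + 1) ≤ Real.sqrt N → ∀ s : ℝ, 1 ≤ s → Metric.ball x₀ (C * (s / H)) ⊆ Θ →
      Pr {ω | ∀ j, (X N ω j : EuclideanSpace ℝ (Fin d)) ∉ Metric.ball x₀ (C * (s / H))} ≤
      ENNReal.ofReal (K * Real.exp (-s ^ 2 / 2)) := by
  obtain ⟨A, K, hA, hK, hX⟩ := hX
  set v := volume.real (Metric.ball (0 : EuclideanSpace ℝ (Fin d)) 1) with hv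
  have hv0 : 0 < v := by
    rw [hv, measureReal_def]
    exact ENNReal.toReal_pos (Metric.measure_ball_pos _ _ one_pos).ne' measure_ball_lt_top.ne
  have hc : 0 < a * v := by positivity
  set C := max 1 ((A + 1) / (a * v)) with hCdef
  have hC1 : 1 ≤ C := le_max_left _ _
  refine ⟨C, K, by positivity, hK, fun N hN H hH hHN s hs hball => ?_⟩
  have hN0 : (0 : ℝ) < N := by exact_mod_cast hN
  have hH0 : (0 : ℝ) < H := by exact_mod_cast hH
  have hH1 : (1 : ℝ) ≤ H := by exact_mod_cast hH
  have hs0 : 0 < s := by linarith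
  have hsq : 0 < Real.sqrt N := Real.sqrt_pos.2 hN0
  have hmass := hp.le_integral_ball hΘ hpm hpa hpQ (by positivity : 0 < C * (s / H)) hball
  -- If no particle falls in the ball, its empirical mass is zero and the deviation is the whole
  -- mass; `C` makes that mass exceed the allowed deviation.
  have hlt : A * (s / Real.sqrt N) < a * v * (C * (s / H)) ^ d := by
    have h1 : A + 1 ≤ a * v * C ^ d := by
      calc A + 1 = a * v * ((A + 1) / (a * v)) := by field_simp
        _ ≤ a * v * C := by
            gcongr
            exact le_max_right _ _
        _ ≤ a * v * C ^ d := by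
            gcongr
            exact le_self_pow₀ hC1 (by omega)
    have h2 : s / Real.sqrt N ≤ (s / H) ^ d := by
      rw [div_pow]
      gcongr
      · exact le_self_pow₀ hs (by omega)
      · exact (pow_le_pow_right₀ hH1 (by omega)).trans hHN
    calc A * (s / Real.sqrt N) < (A + 1) * (s / Real.sqrt N) := by
          gcongr
          linarith
      _ ≤ (a * v * C ^ d) * (s / H) ^ d := by gcongr
      _ = _ := by rw [mul_pow]; ring
  refine (measure_mono ?_).trans (hX N hN
    (fun θ => (Metric.ball x₀ (C * (s / H))).indicator 1 (θ : EuclideanSpace ℝ (Fin d)))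
    (((measurable_const (a := (1 : ℝ))).indicator Metric.isOpen_ball.measurableSet).comp
      measurable_subtype_coe) (fun θ => ?_) s hs)
  · intro ω hω
    rw [mem_ofPred_eq] at hω ⊢
    have e : empMean (fun θ : Θ => (Metric.ball x₀ (C * (s / H))).indicator
        (1 : EuclideanSpace ℝ (Fin d) → ℝ)
        (θ : EuclideanSpace ℝ (Fin d))) (X N ω) = 0 := by
      rw [empMean, Finset.sum_eq_zero fun j _ => indicator_of_notMem (hω j) _, mul_zero]
    rw [e, zero_sub, abs_neg]
    exact (hlt.trans_le hmass).trans_le (le_abs_self _)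
  · by_cases h : (θ : EuclideanSpace ℝ (Fin d)) ∈ Metric.ball x₀ (C * (s / H)) <;> simp [h]

/-- The particle that maximizes the kernel density estimator nearly maximizes the density. -/
theorem Concentrates.density_argmax (hd : 1 ≤ d) {μ : Measure Θ} [IsProbabilityMeasure μ]
    {X : (N : ℕ) → Ω → Fin N → Θ} (hX : Concentrates Pr X μ) (hΘ : IsCompact Θ)
    {k : EuclideanSpace ℝ (Fin d) → ℝ} (hk : IsSmoothingKernel k)
    {p : EuclideanSpace ℝ (Fin d) → ℝ} (hp : IsDensity μ p)
    (hlip : ∃ L : ℝ, ∀ θ ∈ Θ, ∀ θ' ∈ Θ, |p θ - p θ'| ≤ L * ‖θ - θ'‖)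
    {a Q : ℝ} (ha : 0 < a) (hpa : ∀ θ ∈ Θ, a ≤ p θ) (hpQ : ∀ θ ∈ Θ, p θ ≤ Q)
    {x₀ : EuclideanSpace ℝ (Fin d)} (hx₀ : x₀ ∈ interior Θ) :
    ∃ D K : ℝ, 0 ≤ D ∧ 0 ≤ K ∧ ∀ N : ℕ, 1 ≤ N → ∀ H : ℕ, 1 ≤ H →
      (H : ℝ) ^ (d + 1) ≤ Real.sqrt N → bandwidth d N = (H : ℝ)⁻¹ → ∀ s : ℝ, 1 ≤ s →
      Pr {ω | ∃ i, (∀ j, kde k (X N ω) (X N ω j) ≤ kde k (X N ω) (X N ω i)) ∧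
        D * (s / H) < p x₀ - p (X N ω i)} ≤
      ENNReal.ofReal (K * (N : ℝ) ^ d * Real.exp (-s ^ 2 / 2)) := by
  obtain ⟨L, hL, hpL⟩ : ∃ L : ℝ, 0 ≤ L ∧ ∀ θ ∈ Θ, ∀ θ' ∈ Θ, |p θ - p θ'| ≤ L * ‖θ - θ'‖ := by
    obtain ⟨L, hL⟩ := hlip
    exact ⟨|L|, abs_nonneg L, fun θ hθ θ' hθ' =>
      (hL θ hθ θ' hθ').trans (by gcongr; exact le_abs_self L)⟩
  have hx₀Θ := interior_subset hx₀
  have hQ : 0 < Q := ha.trans_le ((hpa x₀ hx₀Θ).trans (hpQ x₀ hx₀Θ))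
  have hpm : Measurable fun θ : Θ => p θ := by
    have : LipschitzWith L.toNNReal fun θ : Θ => p θ := LipschitzWith.of_dist_le_mul
      fun θ θ' => by
        rw [Real.coe_toNNReal _ hL, Real.dist_eq, Subtype.dist_eq, dist_eq_norm]
        exact hpL θ θ.2 θ' θ'.2
    exact this.continuous.measurable
  have hΘm := hΘ.measurableSet
  have hqm := measurable_indicator_of_subtype hΘm hpm
  have hqb : ∀ y, |Θ.indicator p y| ≤ Q := fun y => by
    by_cases hy : y ∈ Θ
    · rw [indicator_of_mem hy, abs_of_nonneg (hp.1 y hy)]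
      exact hpQ y hy
    · simpa [hy] using hQ.le
  obtain ⟨r₁, hr₁, hball⟩ := Metric.isOpen_iff.1 isOpen_interior x₀ hx₀
  obtain ⟨r₀, hr₀, hball⟩ : ∃ r₀ : ℝ, 0 < r₀ ∧ Metric.ball x₀ (r₀ + r₀) ⊆ Θ :=
    ⟨r₁ / 2, by positivity, by rw [add_halves]; exact hball.trans interior_subset⟩
  obtain ⟨D₁, K₁, hD₁, hK₁, huni⟩ := hX.uniform_scaledKernel hΘ hk
  obtain ⟨C, K₂, hC, hK₂, hmem⟩ := hX.exists_mem_ball hd hΘm hp hpm ha hpa hpQ x₀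
  set m₁ := ∫ u, ‖u‖ * k u with hm₁
  have hm₁0 : 0 ≤ m₁ := integral_nonneg fun u => mul_nonneg (norm_nonneg _) (hk.nonneg u)
  -- The density extended by zero may jump at the boundary of `Θ`. Seen from a point at distance at
  -- least `r₀` from the complement, a drop of at most `Q` is dominated by slope `Q / r₀`.
  set L' := L + Q / r₀ with hL'
  have hL'0 : 0 ≤ L' := by positivity
  refine ⟨L * C + 2 * D₁ + 2 * (L' * m₁) + Q * C / r₀, K₁ + K₂, by positivity, by positivity,
    fun N hN H hH hHN hbw s hs => ?_⟩
  have hN1 : (1 : ℝ) ≤ N := by exact_mod_cast hN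
  have hH0 : (0 : ℝ) < H := by exact_mod_cast hH
  have hs0 : 0 < s := by linarith
  have hδ : 0 < s / H := by positivity
  -- If the ball is too large for `Θ`, the term `Q * C / r₀` alone makes the claimed error exceed
  -- `Q`, so the event is empty.
  rcases lt_or_ge r₀ (C * (s / H)) with hr | hr
  · rw [show {ω | ∃ i, (∀ j, kde k (X N ω) (X N ω j) ≤ kde k (X N ω) (X N ω i)) ∧
        (L * C + 2 * D₁ + 2 * (L' * m₁) + Q * C / r₀) * (s / H) < p x₀ - p (X N ω i)} = ∅ from ?_]
    · simp
    refine eq_empty_of_forall_notMem ?_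
    rintro ω ⟨i, -, hi⟩
    have h1 := hp.1 (X N ω i) (X N ω i).2
    have h2 := hpQ x₀ hx₀Θ
    have h3 : Q ≤ Q * C / r₀ * (s / H) := by
      calc Q = Q / r₀ * r₀ := by field_simp
        _ ≤ Q / r₀ * (C * (s / H)) := by gcongr
        _ = _ := by ring
    have h4 : 0 ≤ (L * C + 2 * D₁ + 2 * (L' * m₁)) * (s / H) := by positivity
    rw [add_mul] at hi
    linarith
  · have hsub : Metric.ball x₀ (C * (s / H)) ⊆ Θ :=
      (Metric.ball_subset_ball (by linarith)).trans hball
    have h1 := huni N hN H hH hHN s hs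
    have h2 : Pr {ω | ∀ j, (X N ω j : EuclideanSpace ℝ (Fin d)) ∉
        Metric.ball x₀ (C * (s / H))} ≤
        ENNReal.ofReal (K₂ * (N : ℝ) ^ d * Real.exp (-s ^ 2 / 2)) := by
      refine (hmem N hN H hH hHN s hs hsub).trans (ENNReal.ofReal_le_ofReal ?_)
      gcongr
      exact le_mul_of_one_le_right hK₂ (one_le_pow₀ hN1)
    rw [show (K₁ + K₂) * (N : ℝ) ^ d * Real.exp (-s ^ 2 / 2) =
      K₁ * (N : ℝ) ^ d * Real.exp (-s ^ 2 / 2) + K₂ * (N : ℝ) ^ d * Real.exp (-s ^ 2 / 2) by ring,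
      ENNReal.ofReal_add (by positivity) (by positivity)]
    refine (measure_mono ?_).trans ((measure_union_le _ _).trans (add_le_add h1 h2))
    rintro ω ⟨i, hmax, hi⟩
    by_contra hcon
    simp only [mem_union, mem_ofPred_eq, not_or, not_exists, not_and, not_lt, not_forall,
      not_not] at hcon
    obtain ⟨hunif, j, hj⟩ := hcon
    have hkde : ∀ x, kde k (X N ω) x =
        empMean (fun y : Θ => scaledKernel k (H : ℝ)⁻¹ (x - y)) (X N ω) := fun x => by
      rw [kde, hbw, empMean]
    have h3 := hmax j
    rw [hkde, hkde] at h3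
    have h4 := abs_le.1 (hunif (X N ω i) (X N ω i).2)
    have h5 := abs_le.1 (hunif (X N ω j) (X N ω j).2)
    have hint : ∀ x : EuclideanSpace ℝ (Fin d), ∫ y : Θ, scaledKernel k (H : ℝ)⁻¹ (x - y) ∂μ =
        ∫ y, scaledKernel k (H : ℝ)⁻¹ (x - y) * Θ.indicator p y := fun x =>
      hp.integral_eq hΘm hpm fun y => scaledKernel k (H : ℝ)⁻¹ (x - y)
    rw [hint] at h4 h5
    -- Extension by zero can only lower a nonnegative density, so this upper bound holds with slope
    -- `L` even for a particle at the boundary.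
    have h6 := hk.integral_scaledKernel_mul_le (inv_pos.2 hH0) hqm hqb
      (x := X N ω i) (a := p (X N ω i)) (L := L) fun y => by
        by_cases hy : y ∈ Θ
        · rw [indicator_of_mem hy]
          have := (abs_le.1 (hpL _ (X N ω i).2 y hy)).1
          linarith
        · rw [indicator_of_notMem hy]
          have := hp.1 _ (X N ω i).2
          positivity
    -- The lower bias bound comes from the upper one for the negated density. It is needed only at
    -- the particle `j`, within `r₀` of `x₀` and so at distance at least `r₀` from the complement of
    -- `Θ`.
    have h7 := hk.integral_scaledKernel_mul_le (inv_pos.2 hH0) hqm.neg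
      (fun y => by rw [Pi.neg_apply, abs_neg]; exact hqb y)
      (x := X N ω j) (a := -p (X N ω j)) (L := L') fun y => by
        rw [Pi.neg_apply, hL', add_mul]
        by_cases hy : y ∈ Θ
        · rw [indicator_of_mem hy]
          have h8 := (abs_le.1 (hpL _ (X N ω j).2 y hy)).2
          have h9 : 0 ≤ Q / r₀ * ‖(X N ω j : EuclideanSpace ℝ (Fin d)) - y‖ := by positivity
          linarith
        · rw [indicator_of_notMem hy]
          have h8 : r₀ ≤ ‖(X N ω j : EuclideanSpace ℝ (Fin d)) - y‖ := by
            by_contra hlt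
            rw [not_le] at hlt
            refine hy (hball ?_)
            rw [Metric.mem_ball] at hj ⊢
            rw [← dist_eq_norm, dist_comm] at hlt
            linarith [dist_triangle y (X N ω j : EuclideanSpace ℝ (Fin d)) x₀]
          have h9 : Q ≤ Q / r₀ * ‖(X N ω j : EuclideanSpace ℝ (Fin d)) - y‖ := by
            calc Q = Q / r₀ * r₀ := by field_simp
              _ ≤ _ := by gcongr
          have h10 : 0 ≤ L * ‖(X N ω j : EuclideanSpace ℝ (Fin d)) - y‖ := by positivity
          linarith [hpQ _ (X N ω j).2]
    simp only [Pi.neg_apply, mul_neg, integral_neg] at h7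
    have h8 : p x₀ - p (X N ω j) ≤ L * C * (s / H) := by
      refine (le_abs_self _).trans ((hpL _ hx₀Θ _ (X N ω j).2).trans ?_)
      rw [Metric.mem_ball, dist_comm, dist_eq_norm] at hj
      calc _ ≤ L * (C * (s / H)) := by gcongr
        _ = _ := by ring
    have hHδ : (H : ℝ)⁻¹ ≤ s / H := by
      rw [inv_eq_one_div]
      gcongr
    have h9 : L * m₁ * (H : ℝ)⁻¹ ≤ L' * m₁ * (s / H) := by
      gcongr
      rw [hL']
      exact le_add_of_nonneg_right (by positivity)
    have h10 : L' * m₁ * (H : ℝ)⁻¹ ≤ L' * m₁ * (s / H) := by gcongr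
    have h11 : 0 ≤ Q * C / r₀ * (s / H) := by positivity
    rw [← hm₁] at h6 h7
    have h12 : (L * C + 2 * D₁ + 2 * (L' * m₁) + Q * C / r₀) * (s / H) =
      L * C * (s / H) + 2 * (D₁ * (s / H)) + 2 * (L' * m₁ * (s / H)) + Q * C / r₀ * (s / H) := by
      ring
    rw [h12] at hi
    linarith [h4.1, h4.2, h5.1, h5.2]

end KernelDensityEstimation

/-! ### From tail bounds to an almost surely finite constant. -/

section AlmostSure

variable {Ω : Type*} [MeasurableSpace Ω] {Pr : Measure Ω}

/-- If the probabilities of the events `E N` decay fast enough, the last `N` for which `E N` occurs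
is bounded by an almost surely finite random variable. -/
lemma exists_measurable_bound_of_measure_le {E : ℕ → Set Ω} {K a : ℝ} {d : ℕ} (hK : 0 ≤ K)
    (ha : 0 < a)
    (hE : ∀ N, 1 ≤ N → Pr (E N) ≤
      ENNReal.ofReal (K * (N : ℝ) ^ d * Real.exp (-((N : ℝ) ^ a) ^ 2 / 2))) :
    ∃ V : Ω → ℝ, Measurable V ∧ (∀ ω, 0 ≤ V ω) ∧
      ∀ᵐ ω ∂Pr, ∀ N, 1 ≤ N → ω ∈ E N → (N : ℝ) ≤ V ω := by
  -- The `j`-th term of the exponential series must beat `N ^ (d + 3)`: `d` for the prefactor, one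
  -- for the weight `N`, two for summability.
  obtain ⟨j, hj⟩ := exists_nat_ge ((d + 3) / (2 * a) : ℝ)
  have hdecay : ∀ N : ℕ, 1 ≤ N → K * (N : ℝ) ^ d * Real.exp (-((N : ℝ) ^ a) ^ 2 / 2) * N ≤
      K * (j.factorial * 2 ^ j) * (1 / (N : ℝ) ^ 2) := by
    intro N hN
    have hN1 : (1 : ℝ) ≤ N := by exact_mod_cast hN
    have hN0 : (0 : ℝ) < N := by linarith
    set x := ((N : ℝ) ^ a) ^ 2 / 2 with hx
    have hx0 : 0 < x := by positivity
    have h1 : x ^ j / j.factorial ≤ Real.exp x := Real.pow_div_factorial_le_exp x hx0.le j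
    have h2 : (N : ℝ) ^ (d + 3) ≤ (2 * x) ^ j := by
      have : 2 * x = (N : ℝ) ^ (2 * a) := by
        rw [hx, mul_comm 2 a, Real.rpow_mul hN0.le]
        norm_cast
        ring
      rw [this, ← Real.rpow_mul_natCast hN0.le, ← Real.rpow_natCast]
      refine Real.rpow_le_rpow_of_exponent_le hN1 ?_
      rw [div_le_iff₀ (by positivity)] at hj
      push_cast
      linarith
    have h3 : Real.exp (-((N : ℝ) ^ a) ^ 2 / 2) * (N : ℝ) ^ (d + 3) ≤ j.factorial * 2 ^ j := by
      rw [neg_div, ← hx, Real.exp_neg, inv_mul_le_iff₀ (Real.exp_pos x)]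
      rw [mul_pow] at h2
      rw [div_le_iff₀ (by positivity)] at h1
      calc _ ≤ 2 ^ j * x ^ j := h2
        _ ≤ 2 ^ j * (Real.exp x * j.factorial) := by gcongr
        _ = _ := by ring
    calc _ = K * (Real.exp (-((N : ℝ) ^ a) ^ 2 / 2) * (N : ℝ) ^ (d + 3)) * (1 / (N : ℝ) ^ 2) := by
          rw [pow_add]
          field_simp
      _ ≤ _ := by gcongr
  -- The events are not assumed measurable, so they are replaced by measurable hulls of the same
  -- measure.
  let F : ℕ → Set Ω := fun N => if 1 ≤ N then toMeasurable Pr (E N) else ∅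
  have hF : ∀ N, MeasurableSet (F N) := fun N => by
    by_cases h : 1 ≤ N
    · simp only [F, if_pos h]
      exact measurableSet_toMeasurable _ _
    · simp only [F, if_neg h, MeasurableSet.empty]
  let g : ℕ → Ω → ENNReal := fun N => (F N).indicator fun _ => (N : ENNReal)
  have hg : ∀ N, Measurable (g N) := fun N => measurable_const.indicator (hF N)
  have hfin : ∫⁻ ω, ∑' N, g N ω ∂Pr ≠ ⊤ := by
    rw [lintegral_tsum fun N => (hg N).aemeasurable]
    have hsum : Summable fun N : ℕ => K * (j.factorial * 2 ^ j) * (1 / (N : ℝ) ^ 2) :=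
      (Real.summable_one_div_nat_pow.2 (by norm_num)).mul_left _
    refine ne_top_of_le_ne_top hsum.tsum_ofReal_ne_top (ENNReal.tsum_le_tsum fun N => ?_)
    simp only [g, lintegral_indicator_const (hF N)]
    by_cases h : 1 ≤ N
    · simp only [F, if_pos h, measure_toMeasurable]
      rw [mul_comm]
      calc _ ≤ ENNReal.ofReal (K * (N : ℝ) ^ d * Real.exp (-((N : ℝ) ^ a) ^ 2 / 2)) *
            ENNReal.ofReal N := by
            rw [ENNReal.ofReal_natCast]
            gcongr
            exact hE N h
        _ = ENNReal.ofReal (K * (N : ℝ) ^ d * Real.exp (-((N : ℝ) ^ a) ^ 2 / 2) * N) := by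
            rw [← ENNReal.ofReal_mul (by positivity)]
        _ ≤ _ := ENNReal.ofReal_le_ofReal (hdecay N h)
    · simp [F, h]
  -- The sum of `N` over all occurring events has finite expectation and dominates each such `N`.
  refine ⟨fun ω => (∑' N, g N ω).toReal, (Measurable.tsum hg).ennreal_toReal,
    fun ω => ENNReal.toReal_nonneg, ?_⟩
  filter_upwards [ae_lt_top (Measurable.tsum hg) hfin] with ω hω N hN hωN
  have h1 : g N ω = N := by
    simp only [g, F, if_pos hN]
    exact indicator_of_mem (subset_toMeasurable _ _ hωN) _
  have h2 : (N : ENNReal) ≤ ∑' N, g N ω := h1 ▸ ENNReal.le_tsum N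
  simpa using ENNReal.toReal_mono hω.ne h2

end AlmostSure

/-- Size of the inverse bandwidth. -/
lemma floor_rpow_facts (d : ℕ) {N : ℕ} (hN : 1 ≤ N) :
    1 ≤ ⌊(N : ℝ) ^ (1 / (2 * ((d : ℝ) + 1)))⌋₊ ∧
    ((⌊(N : ℝ) ^ (1 / (2 * ((d : ℝ) + 1)))⌋₊ : ℕ) : ℝ) ^ (d + 1) ≤ Real.sqrt N ∧
    (N : ℝ) ^ (1 / (2 * ((d : ℝ) + 1))) ≤
      2 * ((⌊(N : ℝ) ^ (1 / (2 * ((d : ℝ) + 1)))⌋₊ : ℕ) : ℝ) := by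
  have hN1 : (1 : ℝ) ≤ N := by exact_mod_cast hN
  have h1 : 1 ≤ (N : ℝ) ^ (1 / (2 * ((d : ℝ) + 1))) := Real.one_le_rpow hN1 (by positivity)
  have hfl : 1 ≤ ⌊(N : ℝ) ^ (1 / (2 * ((d : ℝ) + 1)))⌋₊ := by
    rw [Nat.le_floor_iff (by positivity)]
    exact_mod_cast h1
  refine ⟨hfl, ?_, ?_⟩
  · calc _ ≤ ((N : ℝ) ^ (1 / (2 * ((d : ℝ) + 1)))) ^ (d + 1) := by
          gcongr
          exact Nat.floor_le (by positivity)
      _ = Real.sqrt N := by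
          rw [← Real.rpow_mul_natCast (by positivity), Real.sqrt_eq_rpow]
          congr 1
          push_cast
          field_simp
  · have h2 := Nat.lt_floor_add_one ((N : ℝ) ^ (1 / (2 * ((d : ℝ) + 1))))
    have h3 : (1 : ℝ) ≤ ((⌊(N : ℝ) ^ (1 / (2 * ((d : ℝ) + 1)))⌋₊ : ℕ) : ℝ) := by
      exact_mod_cast hfl
    linarith

/-- Multiplying the density gap by `exp b * Z` gives `exp (b - a) - 1`, which is at least `b - a`.
-/
lemma sub_le_exp_mul_of_le {a b C Z : ℝ} (hZ : 0 < Z) (hbC : b ≤ C) (hab : a ≤ b) :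
    b - a ≤ Real.exp C * Z * (Real.exp (-a) / Z - Real.exp (-b) / Z) := by
  have h1 : b - a + 1 ≤ Real.exp (b - a) := Real.add_one_le_exp _
  have h2 : Real.exp b * Z * (Real.exp (-a) / Z - Real.exp (-b) / Z) = Real.exp (b - a) - 1 := by
    have : Real.exp (b - a) = Real.exp b * Real.exp (-a) := by
      rw [← Real.exp_add]
      ring_nf
    rw [this, Real.exp_neg b]
    field_simp
  have h3 : 0 ≤ Real.exp (-a) / Z - Real.exp (-b) / Z := by
    rw [sub_nonneg]
    gcongr
  calc b - a ≤ Real.exp b * Z * (Real.exp (-a) / Z - Real.exp (-b) / Z) := by linarith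
    _ ≤ _ := by gcongr

end PSMCO

end

/-! ### The main theorem. -/

theorem mainTheorem4
    {d n M T : ℕ} (hT : 1 ≤ T)
    -- the compact search space and the components of the cost function
    (Θ : Set (EuclideanSpace ℝ (Fin d))) (hΘ : IsCompact Θ)
    (f : Fin n → Θ → ℝ) (hf_meas : ∀ i, Measurable (f i))
    (hf_bdd : ∃ C : ℝ, ∀ θ : Θ, |PSMCO.cost f θ| ≤ C)
    -- a global minimum is attained in the interior of the search space
    (hf_int : ∃ θ : Θ, (θ : EuclideanSpace ℝ (Fin d)) ∈ interior Θ ∧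
      ∀ θ' : Θ, PSMCO.cost f θ ≤ PSMCO.cost f θ')
    -- prior, and mini-batches `I m t` of worker `m` at time `t`, with bounded potentials
    (π₀ : Measure Θ) [IsProbabilityMeasure π₀]
    (I : Fin M → ℕ → Finset (Fin n))
    (hG : ∀ m, ∀ t, 1 ≤ t → t ≤ T → ∃ C : ℝ, ∀ θ : Θ, PSMCO.potential f (I m t) θ ≤ C)
    -- the densities of the target measures, and their regularity
    (p : Fin M → ℕ → EuclideanSpace ℝ (Fin d) → ℝ)
    (hp : ∀ m, ∀ t, 1 ≤ t → t ≤ T →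
      PSMCO.IsDensity (PSMCO.target π₀ (fun s => PSMCO.potential f (I m s)) t) (p m t))
    (hp_lip : ∀ m, ∀ t, 1 ≤ t → t ≤ T → PSMCO.LipschitzDerivatives Θ (p m t))
    -- the last target density is proportional to `exp (-f)`
    (hpT : ∀ m, ∃ Z : ℝ, 0 < Z ∧ ∀ θ : Θ, p m T θ = Real.exp (-PSMCO.cost f θ) / Z)
    -- jittering kernels and smoothing kernel
    (κ : ℕ → Kernel Θ Θ) [∀ N, IsMarkovKernel (κ N)] (hκ : PSMCO.JitterCondition κ)
    (k : EuclideanSpace ℝ (Fin d) → ℝ) (hk : PSMCO.IsSmoothingKernel k)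
    -- for every number `N` of particles, a run of the sampler by every worker `m`
    {Ω : Type*} [MeasurableSpace Ω] (Pr : Measure Ω) [IsProbabilityMeasure Pr]
    (X Y : Fin M → (N : ℕ) → ℕ → Ω → Fin N → Θ)
    (hrun : ∀ m, ∀ N, 1 ≤ N → PSMCO.IsSamplerRun Pr N T π₀ (κ N)
      (fun s => PSMCO.potential f (I m s)) (X m N) (Y m N))
    -- a global minimizer of the cost function
    (θs : Θ) (hθs : ∀ θ' : Θ, PSMCO.cost f θs ≤ PSMCO.cost f θ')
    (ε : ℝ) (hε₀ : 0 < ε) (hε₁ : ε < 1) :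
    ∃ W : Ω → ℝ, Measurable W ∧
      ∀ᵐ ω ∂Pr, ∀ m : Fin M, ∀ N : ℕ, 1 ≤ N → ∀ i : Fin N,
        (∀ j : Fin N, PSMCO.kde k (X m N T ω) (X m N T ω j) ≤
          PSMCO.kde k (X m N T ω) (X m N T ω i)) →
        0 ≤ PSMCO.cost f (X m N T ω i) - PSMCO.cost f θs ∧
        PSMCO.cost f (X m N T ω i) - PSMCO.cost f θs ≤
          W ω / (N : ℝ) ^ ((1 - ε) / (2 * ((d : ℝ) + 1))) := by
  -- In dimension zero `Θ` has a single point; the particle argument needs `1 ≤ d`.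
  rcases Nat.eq_zero_or_pos d with rfl | hd
  · refine ⟨0, measurable_const, Filter.Eventually.of_forall fun ω m N _ i _ => ?_⟩
    rw [Subsingleton.elim (X m N T ω i) θs]
    simp
  obtain ⟨C, hC⟩ := hf_bdd
  obtain ⟨θ₀, hθ₀, hmin⟩ := hf_int
  have hC0 : 0 ≤ C := (abs_nonneg _).trans (hC θ₀)
  have hθ₀s : PSMCO.cost f θ₀ = PSMCO.cost f θs := le_antisymm (hmin θs) (hθs θ₀)
  choose Z hZ hpZ using hpT
  have hpot : ∀ m t, Measurable (PSMCO.potential f (I m t)) := fun m t => by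
    unfold PSMCO.potential
    fun_prop
  have hpot0 : ∀ m t x, 0 < PSMCO.potential f (I m t) x := fun m t x => Real.exp_pos _
  have hkey : ∀ m, ∃ D K : ℝ, 0 ≤ D ∧ 0 ≤ K ∧ ∀ N : ℕ, 1 ≤ N → ∀ H : ℕ, 1 ≤ H →
      (H : ℝ) ^ (d + 1) ≤ Real.sqrt N → PSMCO.bandwidth d N = (H : ℝ)⁻¹ → ∀ s : ℝ, 1 ≤ s →
      Pr {ω | ∃ i, (∀ j, PSMCO.kde k (X m N T ω) (X m N T ω j) ≤
          PSMCO.kde k (X m N T ω) (X m N T ω i)) ∧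
        D * (s / H) < p m T θ₀ - p m T (X m N T ω i)} ≤
      ENNReal.ofReal (K * (N : ℝ) ^ d * Real.exp (-s ^ 2 / 2)) := by
    intro m
    have := PSMCO.isProbabilityMeasure_target (π₀ := π₀) (hpot m) (hpot0 m) (hG m) T le_rfl
    refine (PSMCO.IsSamplerRun.concentrates (hpot m) (hpot0 m) (hG m) hκ (hrun m) T
      le_rfl).density_argmax hd hΘ hk (hp m T hT le_rfl) (hp_lip m T hT le_rfl).1
      (a := Real.exp (-C) / Z m) (Q := Real.exp C / Z m)
      (div_pos (Real.exp_pos _) (hZ m)) (fun θ hθ => ?_) (fun θ hθ => ?_) hθ₀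
    all_goals
      rw [hpZ m ⟨θ, hθ⟩]
      have h1 := abs_le.1 (hC ⟨θ, hθ⟩)
      have h2 := hZ m
      gcongr
      linarith [h1.1, h1.2]
  choose D K hD hK hDK using hkey
  set e : ℝ := 1 / (2 * ((d : ℝ) + 1)) with he
  have he0 : 0 < e := by positivity
  let H : ℕ → ℕ := fun N => ⌊(N : ℝ) ^ e⌋₊
  -- The level `s = N ^ (ε * e)` gives up a fraction `ε` of the rate exponent in exchange for tails
  -- that decay faster than any power of `N`.
  let E : ℕ → Set Ω := fun N => ⋃ m, {ω | ∃ i, (∀ j, PSMCO.kde k (X m N T ω) (X m N T ω j) ≤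
      PSMCO.kde k (X m N T ω) (X m N T ω i)) ∧
    D m * ((N : ℝ) ^ (ε * e) / H N) < p m T θ₀ - p m T (X m N T ω i)}
  have hE : ∀ N, 1 ≤ N → Pr (E N) ≤ ENNReal.ofReal ((∑ m, K m) * (N : ℝ) ^ d *
      Real.exp (-((N : ℝ) ^ (ε * e)) ^ 2 / 2)) := by
    intro N hN
    have hN1 : (1 : ℝ) ≤ N := by exact_mod_cast hN
    obtain ⟨h1, h2, -⟩ := PSMCO.floor_rpow_facts d hN
    refine (measure_iUnion_fintype_le _ _).trans ?_
    rw [Finset.sum_mul, Finset.sum_mul, ENNReal.ofReal_sum_of_nonneg fun m _ =>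
      mul_nonneg (mul_nonneg (hK m) (by positivity)) (Real.exp_pos _).le]
    exact Finset.sum_le_sum fun m _ => hDK m N hN (H N) h1 h2 rfl _
      (Real.one_le_rpow hN1 (by positivity))
  obtain ⟨V, hVm, hV0, hV⟩ := PSMCO.exists_measurable_bound_of_measure_le
    (Finset.sum_nonneg fun m _ => hK m) (mul_pos hε₀ he0) hE
  have hB0 : ∀ m, 0 ≤ Real.exp C * Z m * D m := fun m =>
    mul_nonneg (mul_nonneg (Real.exp_pos C).le (hZ m).le) (hD m)
  set B : ℝ := ∑ m, Real.exp C * Z m * D m with hB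
  have hBm : ∀ m, Real.exp C * Z m * D m ≤ B := fun m =>
    Finset.single_le_sum (f := fun m => Real.exp C * Z m * D m) (fun m _ => hB0 m)
      (Finset.mem_univ m)
  have hBnn : 0 ≤ B := Finset.sum_nonneg fun m _ => hB0 m
  -- `2 * B` covers the `N` outside the bad events, the 2 coming from the floor in the bandwidth. `2
  -- * C * V` covers the bad ones: the cost gap is at most `2 * C`, and the power of `N` is at most
  -- `N ≤ V ω`.
  refine ⟨fun ω => 2 * B + 2 * C * V ω, by fun_prop, ?_⟩
  filter_upwards [hV] with ω hω m N hN i hmax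
  refine ⟨sub_nonneg.2 (hθs _), ?_⟩
  have hN1 : (1 : ℝ) ≤ N := by exact_mod_cast hN
  have hN0 : (0 : ℝ) < N := by linarith
  have hexp : (1 - ε) / (2 * ((d : ℝ) + 1)) = e - ε * e := by
    rw [he]
    ring
  have hpow : 0 < (N : ℝ) ^ (e - ε * e) := by positivity
  rw [hexp]
  by_cases hωN : ω ∈ E N
  · have h1 := hω N hN hωN
    rw [le_div_iff₀ hpow]
    have h2 : (N : ℝ) ^ (e - ε * e) ≤ N := by
      conv_rhs => rw [← Real.rpow_one (N : ℝ)]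
      refine Real.rpow_le_rpow_of_exponent_le hN1 ?_
      have h3 : e ≤ 1 := by
        rw [he]
        exact div_le_one_of_le₀ (by linarith [Nat.cast_nonneg (α := ℝ) d]) (by positivity)
      have h4 := mul_pos hε₀ he0
      linarith
    have h3 : PSMCO.cost f (X m N T ω i) - PSMCO.cost f θs ≤ 2 * C := by
      linarith [(abs_le.1 (hC (X m N T ω i))).2, (abs_le.1 (hC θs)).1]
    calc _ ≤ 2 * C * V ω := by
          gcongr
          exact h2.trans h1
      _ ≤ _ := by linarith
  · have h1 : p m T θ₀ - p m T (X m N T ω i) ≤ D m * ((N : ℝ) ^ (ε * e) / H N) := by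
      by_contra hcon
      exact hωN (mem_iUnion.2 ⟨m, i, hmax, not_le.1 hcon⟩)
    obtain ⟨h2, -, h3⟩ := PSMCO.floor_rpow_facts d hN
    have hH0 : (0 : ℝ) < H N := Nat.cast_pos.2 h2
    have h4 : (N : ℝ) ^ (ε * e) / H N ≤ 2 / (N : ℝ) ^ (e - ε * e) := by
      rw [div_le_div_iff₀ hH0 hpow, ← Real.rpow_add hN0, add_sub_cancel]
      exact h3
    have h5 := PSMCO.sub_le_exp_mul_of_le (hZ m) (abs_le.1 (hC (X m N T ω i))).2
      (hmin (X m N T ω i))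
    rw [← hpZ, ← hpZ] at h5
    rw [← hθ₀s]
    have hZ0 := hZ m
    have hDm := hD m
    calc _ ≤ _ := h5
      _ ≤ Real.exp C * Z m * (D m * (2 / (N : ℝ) ^ (e - ε * e))) := by
          gcongr
          exact h1.trans (by gcongr)
      _ = Real.exp C * Z m * D m * (2 / (N : ℝ) ^ (e - ε * e)) := by ring
      _ ≤ B * (2 / (N : ℝ) ^ (e - ε * e)) := by
          gcongr
          exact hBm m
      _ = 2 * B / (N : ℝ) ^ (e - ε * e) := by ring
      _ ≤ _ := by
          gcongr
          have := hV0 ω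
          have : 0 ≤ 2 * C * V ω := by positivity
          linarith
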